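/- Let $\mathcal H_1,\mathcal H_2$ be finite-dimensional complex Hilbert spaces. A channel is a completely positive unital linear map $T:\mathcal B(\mathcal H_2)\to\mathcal B(\mathcal H_1)$ (Heisenberg picture). For a linear map $T:\mathcal B(\mathcal H_2)\to\mathcal B(\mathcal H_1)$ put $$\|T\|_{\rm cb}=\sup\{\|(T\otimes\mathrm{id}_k)(A)\| : k\in\mathbb N,\ A\in\mathcal B(\mathcal H_2\otimes\mathbb C^k),\ \|A\|\le 1\},$$ where $\|\cdot\|$ is the operator norm, and for $M\in\mathbb N$ let $$\Delta(T,M)=\inf_{E,D}\|ETD-\mathrm{Id}\|_{\rm cb},$$ where the infimum is over all channels $D:\mathcal B(\mathbb C^M)\to\mathcal B(\mathcal H_2)$ (decodings) and $E:\mathcal B(\mathcal H_1)\to\mathcal B(\mathbb C^M)$ (encodings). A real number $c\ge 0$ is an achievable rate for $T$ if $\lim_{n\to\infty}\Delta(T^{\otimes n},\lfloor 2^{cn}\rfloor)=0$, and the quantum capacity $Q(T)\in[-\infty,\infty]$ is the supremum of all achievable rates. Let $T$ be a channel and let $c$ be a real number with $0\le c<Q(T)$. Then there is a constant $\lambda(c)>0$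 (which may depend on $T$ and $c$, but not on $n$) such that, for all sufficiently large $n$, $$\Delta\bigl(T^{\otimes n},2^{\lfloor cn\rfloor}\bigr)\le e^{-n\lambda(c)}.$$ -/

import Mathlib

/-! Finite quantum systems are described by `ℂ^ι` for a finite index type `ι`; the algebra of
observables `𝓑(ℂ^ι)` is `Matrix ι ι ℂ` with the operator norm of `ℂ^ι` as a Hilbert space, and
`ℂ^ι ⊗ ℂ^κ = ℂ^(ι × κ)`, `(ℂ^ι)^{⊗n} = ℂ^(Fin n → ι)`.  Maps are in the Heisenberg picture. -/

namespace QuantumChannel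

open scoped ENNReal Topology ComplexOrder Matrix.Norms.L2Operator

variable {ι κ : Type*} [Fintype ι] [DecidableEq ι] [Fintype κ] [DecidableEq κ]

/-- The map `T ⊗ id_k : 𝓑(ℂ^ι ⊗ ℂ^k) → 𝓑(ℂ^κ ⊗ ℂ^k)`, that is, `T` applied to each of the
`k × k` blocks. -/
def ampliation (k : ℕ) (T : Matrix ι ι ℂ →ₗ[ℂ] Matrix κ κ ℂ) :
    Matrix (ι × Fin k) (ι × Fin k) ℂ →ₗ[ℂ] Matrix (κ × Fin k) (κ × Fin k) ℂ where
  toFun A := Matrix.of fun x y => T (Matrix.of fun i j => A (i, x.2) (j, y.2)) x.1 y.1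
  map_add' A B := by
    ext x y
    exact congrFun₂ (map_add T (Matrix.of fun i j => A (i, x.2) (j, y.2))
      (Matrix.of fun i j => B (i, x.2) (j, y.2))) x.1 y.1
  map_smul' c A := by
    ext x y
    exact congrFun₂ (map_smul T c (Matrix.of fun i j => A (i, x.2) (j, y.2))) x.1 y.1

/-- Complete positivity: every `T ⊗ id_k` maps positive semidefinite operators to positive
semidefinite operators. -/
def IsCompletelyPositive (T : Matrix ι ι ℂ →ₗ[ℂ] Matrix κ κ ℂ) : Prop :=
  ∀ (k : ℕ) (A : Matrix (ι × Fin k) (ι × Fin k) ℂ), A.PosSemidef → (ampliation k T A).PosSemidef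

/-- A channel `T : 𝓑(ℂ^ι) → 𝓑(ℂ^κ)` is a completely positive unital map (it transforms states
of the system `ℂ^κ` into states of the system `ℂ^ι`). -/
structure IsChannel (T : Matrix ι ι ℂ →ₗ[ℂ] Matrix κ κ ℂ) : Prop where
  completelyPositive : IsCompletelyPositive T
  unital : T 1 = 1

/-- The norm of complete boundedness, the supremum of `‖(T ⊗ id_k)(A)‖` over all `k` and all `A`
with `‖A‖ ≤ 1`, where `‖·‖` is the operator norm. -/
noncomputable def cbNorm (T : Matrix ι ι ℂ →ₗ[ℂ] Matrix κ κ ℂ) : ℝ≥0∞ :=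
  ⨆ (k : ℕ) (A : Matrix (ι × Fin k) (ι × Fin k) ℂ) (_ : ‖A‖ ≤ 1), ‖ampliation k T A‖ₑ

/-- The tensor power `T^{⊗n} : 𝓑((ℂ^ι)^{⊗n}) → 𝓑((ℂ^κ)^{⊗n})`, given by its values on the
products of matrix units. -/
def tensorPower (T : Matrix ι ι ℂ →ₗ[ℂ] Matrix κ κ ℂ) (n : ℕ) :
    Matrix (Fin n → ι) (Fin n → ι) ℂ →ₗ[ℂ] Matrix (Fin n → κ) (Fin n → κ) ℂ where
  toFun A := Matrix.of fun x y =>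
    ∑ u : Fin n → ι, ∑ v : Fin n → ι,
      A u v * ∏ i, T (Matrix.single (u i) (v i) 1) (x i) (y i)
  map_add' A B := by
    ext x y
    simp [add_mul, Finset.sum_add_distrib]
  map_smul' c A := by
    ext x y
    simp [Finset.mul_sum, mul_assoc]

/-- The optimal coding error `Δ(T, M)`: the infimum of `‖E T D - id‖_cb` over all channels
`D : 𝓑(ℂ^M) → 𝓑(ℂ^ι)` (decodings) and `E : 𝓑(ℂ^κ) → 𝓑(ℂ^M)` (encodings). -/
noncomputable def codingError (T : Matrix ι ι ℂ →ₗ[ℂ] Matrix κ κ ℂ) (M : ℕ) : ℝ≥0∞ :=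
  ⨅ (E : Matrix κ κ ℂ →ₗ[ℂ] Matrix (Fin M) (Fin M) ℂ) (_ : IsChannel E)
    (D : Matrix (Fin M) (Fin M) ℂ →ₗ[ℂ] Matrix ι ι ℂ) (_ : IsChannel D),
    cbNorm (E ∘ₗ T ∘ₗ D - LinearMap.id)

/-- `c ≥ 0` is an achievable rate for `T` if `Δ(T^{⊗n}, ⌊2^{cn}⌋) → 0`. -/
def IsAchievableRate (T : Matrix ι ι ℂ →ₗ[ℂ] Matrix κ κ ℂ) (c : ℝ) : Prop :=
  0 ≤ c ∧ Filter.Tendsto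
    (fun n : ℕ => codingError (tensorPower T n) ⌊(2 : ℝ) ^ (c * (n : ℝ))⌋₊) Filter.atTop (𝓝 0)

/-- The quantum capacity, the supremum of all achievable rates, as an extended real number. -/
noncomputable def quantumCapacity (T : Matrix ι ι ℂ →ₗ[ℂ] Matrix κ κ ℂ) : EReal :=
  ⨆ (c : ℝ) (_ : IsAchievableRate T c), (c : EReal)

/-- `T^{⊗n}(A₁ ⊗ ⋯ ⊗ Aₙ) = T(A₁) ⊗ ⋯ ⊗ T(Aₙ)`. -/
theorem tensorPower_prod (T : Matrix ι ι ℂ →ₗ[ℂ] Matrix κ κ ℂ) (n : ℕ)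
    (A : Fin n → Matrix ι ι ℂ) :
    tensorPower T n (Matrix.of fun u v => ∏ i, A i (u i) (v i)) =
      Matrix.of fun x y => ∏ i, T (A i) (x i) (y i) := by
  ext x y
  have h : ∀ i, T (A i) (x i) (y i) =
      ∑ p : ι × ι, A i p.1 p.2 * T (Matrix.single p.1 p.2 1) (x i) (y i) := by
    intro i
    conv_lhs => rw [Matrix.matrix_eq_sum_single (A i)]
    rw [Fintype.sum_prod_type]
    simp only [map_sum, Matrix.sum_apply]
    refine Finset.sum_congr rfl fun a _ => Finset.sum_congr rfl fun b _ => ?_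
    have : Matrix.single a b (A i a b) = A i a b • Matrix.single a b (1 : ℂ) := by
      simp [Matrix.smul_single]
    rw [this, map_smul]
    rfl
  simp only [tensorPower, LinearMap.coe_mk, AddHom.coe_mk, Matrix.of_apply, h]
  rw [Finset.prod_univ_sum, Fintype.piFinset_univ, ← Fintype.sum_prod_type']
  refine (Fintype.sum_equiv (Equiv.arrowProdEquivProdArrow (Fin n) (fun _ => ι) (fun _ => ι)) _ _ ?_).symm
  intro p
  simp [Equiv.arrowProdEquivProdArrow, Finset.prod_mul_distrib]

theorem nonneg_iff_star_mul_self (B : Type*) [CStarAlgebra B] [PartialOrder B] [StarOrderedRing B]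
    (M : B) : 0 ≤ M ↔ ∃ N, M = star N * N :=
  CStarAlgebra.nonneg_iff_eq_star_mul_self

open scoped MatrixOrder CStarAlgebra in
theorem cstarMatrix_nonneg_iff (k : ℕ) (M : CStarMatrix (Fin k) (Fin k) (Matrix ι ι ℂ)) :
    0 ≤ M ↔ (Matrix.of fun (x y : ι × Fin k) => M x.2 y.2 x.1 y.1).PosSemidef := by
  rw [← Matrix.nonneg_iff_posSemidef]
  have comp : ∀ N : CStarMatrix (Fin k) (Fin k) (Matrix ι ι ℂ),
      (Matrix.of fun (x y : ι × Fin k) => (star N * N) x.2 y.2 x.1 y.1) =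
      star (Matrix.of fun (x y : ι × Fin k) => N x.2 y.2 x.1 y.1) *
        Matrix.of fun (x y : ι × Fin k) => N x.2 y.2 x.1 y.1 := by
    intro N
    ext x y
    simp [CStarMatrix.mul_apply, CStarMatrix.star_apply, Matrix.mul_apply, Matrix.sum_apply,
      Fintype.sum_prod_type_right, Matrix.star_apply]
  refine (nonneg_iff_star_mul_self _ M).trans
    (Iff.trans ?_ (nonneg_iff_star_mul_self _ _).symm)
  constructor
  · rintro ⟨N, rfl⟩
    exact ⟨_, comp N⟩
  · rintro ⟨B, hB⟩
    refine ⟨CStarMatrix.ofMatrix (Matrix.of fun p q => Matrix.of fun i j => B (i, p) (j, q)), ?_⟩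
    have h2 := comp (CStarMatrix.ofMatrix
      (Matrix.of fun p q => Matrix.of fun i j => B (i, p) (j, q)))
    have h3 := hB.trans h2.symm
    ext p q i j
    exact congrFun₂ h3 (i, p) (j, q)

open scoped MatrixOrder CStarAlgebra in
/-- Complete positivity as defined here agrees with complete positivity of maps of
C⋆-algebras. -/
theorem isCompletelyPositive_iff (T : Matrix ι ι ℂ →ₗ[ℂ] Matrix κ κ ℂ) :
    IsCompletelyPositive T ↔ ∃ Φ : Matrix ι ι ℂ →CP Matrix κ κ ℂ, Φ.toLinearMap = T := by
  constructor
  · intro h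
    refine ⟨⟨T, fun k M hM => ?_⟩, rfl⟩
    rw [cstarMatrix_nonneg_iff] at hM ⊢
    exact h k _ hM
  · rintro ⟨Φ, rfl⟩ k A hA
    have := Φ.map_cstarMatrix_nonneg' k
      (CStarMatrix.ofMatrix (Matrix.of fun p q => Matrix.of fun i j => A (i, p) (j, q)))
      ((cstarMatrix_nonneg_iff k _).2 hA)
    exact (cstarMatrix_nonneg_iff k _).1 this

end QuantumChannel

/-!
Below capacity the optimal coding error decays exponentially, because a channel that is merely
close to the identity can be improved by an error correcting code of rate close to `1`.

Let `c < c'` with `c'` achievable. For a large but fixed block length `m` there are an encoding `E`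
and a decoding `D` with `R = E T^{⊗m} D` close to the identity on `ℂ^F`, where `F` is the field with
`2 ^ a` elements and `a = ⌊c' m⌋`: `‖R - id‖_cb ≤ ε` for an `ε` chosen in advance. Expand
`R^{⊗K} = (id + S)^{⊗K}`, `S = R - id`, into terms that carry `S` on a set `s` of factors and the
identity elsewhere. A term has norm at most `ε ^ |s|` (`cbNorm_tensorMap_ite_le`). A code correcting
`f` errors turns every term with `|s| ≤ f` into a multiple of the identity, and for `s ≠ ∅` this
multiple is zero since `S 1 = 0`. So only terms with `|s| > f` survive, and the error of the
concatenated code is at most `2 ^ K ε ^ (f + 1)` (`exists_coding_of_code`). With `f = ⌊K / L⌋` and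
`ε = 8 ^ (-L)` this is at most `4 ^ (-K)`, exponentially small in `n ≈ m K`.

The codes come from linear maps `g : F^r × F^k → F^K` by `|s⟩ ↦ q^{-k/2} ∑ₜ |g (s, t)⟩`. If no
nonzero vector is mapped to a vector of weight at most `2 f` and `g (0, ·)` is onto any `2 f`
coordinates, then every operator on at most `2 f` factors acts between code states as a scalar, its
normalised trace (`codeIsometry_knillLaflamme`). This is a Knill–Laflamme condition, and a decoder is built
from an orthonormal basis of the operators on at most `f` factors (`exists_decoder`). A counting
argument gives such `g` with rate `r / K` close to `1 - 4 / L - 2 / a` (`exists_linear_code`). For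
`L` and `m` large, the loss of rate is less than `c' - c` (`rate_bound`).
-/

namespace QuantumChannel

open scoped ENNReal Topology ComplexOrder Matrix.Norms.L2Operator Kronecker
open Matrix

set_option linter.unusedSectionVars false

/-! ### Contractivity of operator sums -/

section Norms

variable {ι κ J : Type*} [Fintype ι] [DecidableEq ι] [Fintype κ] [DecidableEq κ]
  [Fintype J] [DecidableEq J]

theorem norm_submatrix_equiv_le (f : κ ≃ ι) (A : Matrix ι ι ℂ) :
    ‖A.submatrix f f‖ ≤ ‖A‖ :=
  NonUnitalStarAlgHom.norm_apply_le
    ({ toFun := fun X => X.submatrix f f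
       map_smul' := fun _ _ => rfl
       map_zero' := rfl
       map_add' := fun _ _ => rfl
       map_mul' := fun X Y => (submatrix_mul_equiv X Y f f f).symm
       map_star' := fun _ => rfl } : Matrix ι ι ℂ →⋆ₙₐ[ℂ] Matrix κ κ ℂ) A

theorem norm_submatrix_equiv (f : κ ≃ ι) (A : Matrix ι ι ℂ) : ‖A.submatrix f f‖ = ‖A‖ := by
  refine le_antisymm (norm_submatrix_equiv_le f A) ?_
  simpa using norm_submatrix_equiv_le f.symm (A.submatrix f f)

theorem norm_one_kronecker_le (A : Matrix ι ι ℂ) : ‖(1 : Matrix J J ℂ) ⊗ₖ A‖ ≤ ‖A‖ :=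
  NonUnitalStarAlgHom.norm_apply_le
    ({ toFun := fun X => (1 : Matrix J J ℂ) ⊗ₖ X
       map_smul' := fun c X => kronecker_smul c 1 X
       map_zero' := kronecker_zero 1
       map_add' := fun X Y => kronecker_add 1 X Y
       map_mul' := fun X Y => by
         rw [← mul_kronecker_mul, one_mul]
       map_star' := fun X => by
         simp [star_eq_conjTranspose, conjTranspose_kronecker] } :
      Matrix ι ι ℂ →⋆ₙₐ[ℂ] Matrix (J × ι) (J × ι) ℂ) A

/-- An operator-sum `X ↦ ∑ Kₗᴴ X Kₗ` with `∑ Kₗᴴ Kₗ = 1` is contractive: stacking the `Kₗ` gives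
an isometry `W` with `∑ Kₗᴴ X Kₗ = Wᴴ (1 ⊗ X) W`. -/
theorem norm_sum_conjTranspose_mul_mul_le (K : J → Matrix ι κ ℂ) (hK : ∑ l, (K l)ᴴ * K l = 1)
    (X : Matrix ι ι ℂ) : ‖∑ l, (K l)ᴴ * X * K l‖ ≤ ‖X‖ := by
  let W : Matrix (J × ι) κ ℂ := Matrix.of fun p x => K p.1 p.2 x
  have key : ∀ X : Matrix ι ι ℂ, ∑ l, (K l)ᴴ * X * K l = Wᴴ * ((1 : Matrix J J ℂ) ⊗ₖ X) * W := by
    intro X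
    ext x y
    simp [W, Matrix.mul_apply, Matrix.sum_apply, Fintype.sum_prod_type, Matrix.one_apply]
  have hW : ‖W‖ ≤ 1 := by
    have h1 : Wᴴ * W = 1 := by
      rw [← hK]
      have := key 1
      simpa using this.symm
    have h2 := l2_opNorm_conjTranspose_mul_self W
    rw [h1] at h2
    have h3 : ‖(1 : Matrix κ κ ℂ)‖ ≤ 1 := by
      rw [← diagonal_one, l2_opNorm_diagonal]
      exact (pi_norm_le_iff_of_nonneg zero_le_one).2 fun i => by simp
    nlinarith [norm_nonneg W]
  rw [key]
  calc ‖Wᴴ * ((1 : Matrix J J ℂ) ⊗ₖ X) * W‖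
      ≤ ‖Wᴴ‖ * ‖(1 : Matrix J J ℂ) ⊗ₖ X‖ * ‖W‖ :=
        (l2_opNorm_mul _ _).trans (by gcongr; exact l2_opNorm_mul _ _)
    _ ≤ 1 * ‖X‖ * 1 := by
        rw [l2_opNorm_conjTranspose]
        gcongr
        exact norm_one_kronecker_le X
    _ = ‖X‖ := by ring

end Norms

/-! ### Kraus operators -/

section Kraus

variable {ι κ ι' J : Type*} [Fintype ι] [DecidableEq ι] [Fintype κ] [DecidableEq κ]
  [Fintype ι'] [DecidableEq ι'] [Fintype J]

/-- The operator-sum form passes to `T ⊗ id_k`, with `K ⊗ 1` in place of `K`. -/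
theorem ampliation_kraus (k : ℕ) (T : Matrix ι ι ℂ →ₗ[ℂ] Matrix κ κ ℂ) (K : J → Matrix ι κ ℂ)
    (hK : ∀ X, T X = ∑ l, (K l)ᴴ * X * K l) (A : Matrix (ι × Fin k) (ι × Fin k) ℂ) :
    ampliation k T A = ∑ l, (K l ⊗ₖ (1 : Matrix (Fin k) (Fin k) ℂ))ᴴ * A *
      (K l ⊗ₖ (1 : Matrix (Fin k) (Fin k) ℂ)) := by
  ext x y
  rw [Matrix.sum_apply]
  simp only [ampliation, LinearMap.coe_mk, AddHom.coe_mk, Matrix.of_apply, hK, Matrix.sum_apply]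
  refine Finset.sum_congr rfl fun l _ => ?_
  rw [Matrix.mul_apply, Matrix.mul_apply, Fintype.sum_prod_type]
  simp [Matrix.mul_apply, Fintype.sum_prod_type, Matrix.one_apply, apply_ite, ite_mul]

theorem isCompletelyPositive_of_kraus {T : Matrix ι ι ℂ →ₗ[ℂ] Matrix κ κ ℂ}
    (K : J → Matrix ι κ ℂ) (hK : ∀ X, T X = ∑ l, (K l)ᴴ * X * K l) : IsCompletelyPositive T := by
  intro k A hA
  rw [ampliation_kraus k T K hK]
  exact posSemidef_sum _ fun l _ => hA.conjTranspose_mul_mul_same _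

open scoped MatrixOrder in
/-- Kraus representation: a factorisation `C = Bᴴ B` of the Choi matrix of `T` yields the Kraus
operators. -/
theorem IsCompletelyPositive.exists_kraus {T : Matrix ι ι ℂ →ₗ[ℂ] Matrix κ κ ℂ}
    (hT : IsCompletelyPositive T) :
    ∃ K : κ × Fin (Fintype.card ι) → Matrix ι κ ℂ, ∀ X, T X = ∑ l, (K l)ᴴ * X * K l := by
  let e := Fintype.equivFin ι
  -- The Choi matrix is the image of the projector on the maximally entangled vector `w`,
  -- up to normalisation.
  let w : ι × Fin (Fintype.card ι) → ℂ := fun p => if e p.1 = p.2 then 1 else 0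
  have h1 : (vecMulVec (star w) w).PosSemidef := by
    simpa using posSemidef_vecMulVec_star_self w
  have h2 := hT _ _ h1
  obtain ⟨B, hB⟩ := CStarAlgebra.nonneg_iff_eq_star_mul_self.1 (nonneg_iff_posSemidef.2 h2)
  refine ⟨fun l => Matrix.of fun p x => B l (x, e p), fun X => ?_⟩
  have h3 : ∀ p q x y, T (Matrix.single p q 1) x y = ∑ l, star (B l (x, e p)) * B l (y, e q) := by
    intro p q x y
    have h4 := congrFun₂ hB (x, e p) (y, e q)
    rw [Matrix.mul_apply] at h4
    simp only [Matrix.star_apply] at h4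
    rw [← h4]
    have h5 : Matrix.single p q (1 : ℂ) =
        Matrix.of fun i j => vecMulVec (star w) w (i, e p) (j, e q) := by
      ext i j
      simp [Matrix.single_apply, vecMulVec_apply, w, ← ite_and, eq_comm, and_comm]
    rw [h5]
    rfl
  ext x y
  conv_lhs => rw [Matrix.matrix_eq_sum_single X]
  have h5 : ∀ p q, T (Matrix.single p q (X p q)) x y = X p q * T (Matrix.single p q 1) x y := by
    intro p q
    have : Matrix.single p q (X p q) = X p q • Matrix.single p q (1 : ℂ) := by
      simp [Matrix.smul_single]
    rw [this, map_smul]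
    rfl
  simp only [map_sum, Matrix.sum_apply, h5, h3, Matrix.mul_apply, Finset.mul_sum, Finset.sum_mul,
    conjTranspose_apply, Matrix.of_apply]
  calc _ = ∑ p, ∑ l, ∑ q, X p q * (star (B l (x, e p)) * B l (y, e q)) :=
        Finset.sum_congr rfl fun p _ => Finset.sum_comm
    _ = ∑ l, ∑ p, ∑ q, X p q * (star (B l (x, e p)) * B l (y, e q)) := Finset.sum_comm
    _ = ∑ l, ∑ q, ∑ p, X p q * (star (B l (x, e p)) * B l (y, e q)) :=
        Finset.sum_congr rfl fun l _ => Finset.sum_comm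
    _ = _ := by
        refine Finset.sum_congr rfl fun l _ => Finset.sum_congr rfl fun q _ =>
          Finset.sum_congr rfl fun p _ => ?_
        ring

theorem isChannel_of_kraus {T : Matrix ι ι ℂ →ₗ[ℂ] Matrix κ κ ℂ} (K : J → Matrix ι κ ℂ)
    (hK : ∀ X, T X = ∑ l, (K l)ᴴ * X * K l) (h1 : ∑ l, (K l)ᴴ * K l = 1) : IsChannel T :=
  ⟨isCompletelyPositive_of_kraus K hK, by simp [hK, h1]⟩

/-- The map `X ↦ Vᴴ X V`, a channel if `V` is an isometry. -/
def compression (V : Matrix ι κ ℂ) : Matrix ι ι ℂ →ₗ[ℂ] Matrix κ κ ℂ where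
  toFun X := Vᴴ * X * V
  map_add' X Y := by simp [Matrix.mul_add, Matrix.add_mul]
  map_smul' c X := by simp

theorem compression_apply (V : Matrix ι κ ℂ) (X : Matrix ι ι ℂ) :
    compression V X = Vᴴ * X * V := rfl

theorem isChannel_compression {V : Matrix ι κ ℂ} (hV : Vᴴ * V = 1) : IsChannel (compression V) :=
  isChannel_of_kraus (fun _ : Unit => V) (fun X => by simp [compression_apply]) (by simpa using hV)

theorem ampliation_comp (k : ℕ) (S : Matrix κ κ ℂ →ₗ[ℂ] Matrix ι' ι' ℂ)
    (T : Matrix ι ι ℂ →ₗ[ℂ] Matrix κ κ ℂ) (A : Matrix (ι × Fin k) (ι × Fin k) ℂ) :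
    ampliation k (S ∘ₗ T) A = ampliation k S (ampliation k T A) := rfl

theorem IsChannel.comp {S : Matrix κ κ ℂ →ₗ[ℂ] Matrix ι' ι' ℂ}
    {T : Matrix ι ι ℂ →ₗ[ℂ] Matrix κ κ ℂ} (hS : IsChannel S) (hT : IsChannel T) :
    IsChannel (S ∘ₗ T) :=
  ⟨fun k _ hA => hS.1 k _ (hT.1 k _ hA), by simp [hT.2, hS.2]⟩

end Kraus

/-! ### The norm of complete boundedness -/

section CbNorm

variable {ι κ ι' κ' J : Type*} [Fintype ι] [DecidableEq ι] [Fintype κ] [DecidableEq κ]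
  [Fintype ι'] [DecidableEq ι'] [Fintype κ'] [DecidableEq κ'] [Fintype J] [DecidableEq J]

theorem enorm_ampliation_le (k : ℕ) (T : Matrix ι ι ℂ →ₗ[ℂ] Matrix κ κ ℂ)
    (A : Matrix (ι × Fin k) (ι × Fin k) ℂ) : ‖ampliation k T A‖ₑ ≤ cbNorm T * ‖A‖ₑ := by
  rcases eq_or_ne A 0 with rfl | hA
  · simp
  have h0 : ‖A‖ ≠ 0 := norm_ne_zero_iff.2 hA
  have h1 : ‖((‖A‖⁻¹ : ℝ) : ℂ) • A‖ ≤ 1 := by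
    rw [norm_smul]
    simp [h0]
  have h2 : ‖ampliation k T (((‖A‖⁻¹ : ℝ) : ℂ) • A)‖ₑ ≤ cbNorm T :=
    le_iSup_of_le k (le_iSup_of_le _ (le_iSup_of_le h1 le_rfl))
  have h3 : A = ((‖A‖ : ℝ) : ℂ) • ((‖A‖⁻¹ : ℝ) : ℂ) • A := by
    rw [smul_smul, ← Complex.ofReal_mul, mul_inv_cancel₀ h0]
    simp
  have h4 : ‖((‖A‖ : ℝ) : ℂ)‖ₑ = ‖A‖ₑ := by
    rw [← ofReal_norm, ← ofReal_norm]
    simp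
  calc ‖ampliation k T A‖ₑ
      = ‖((‖A‖ : ℝ) : ℂ) • ampliation k T (((‖A‖⁻¹ : ℝ) : ℂ) • A)‖ₑ := by
        rw [← map_smul, ← h3]
    _ = ‖A‖ₑ * ‖ampliation k T (((‖A‖⁻¹ : ℝ) : ℂ) • A)‖ₑ := by rw [enorm_smul, h4]
    _ ≤ ‖A‖ₑ * cbNorm T := by gcongr
    _ = _ := mul_comm _ _

/-- The bound by the norm of complete boundedness holds for an environment with any finite index
type, not only `Fin k`. -/
theorem enorm_blocks_le (T : Matrix ι ι ℂ →ₗ[ℂ] Matrix κ κ ℂ)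
    (A : Matrix (ι × J) (ι × J) ℂ) :
    ‖(Matrix.of fun x y : κ × J =>
        T (Matrix.of fun i j => A (i, x.2) (j, y.2)) x.1 y.1)‖ₑ ≤ cbNorm T * ‖A‖ₑ := by
  let e := Fintype.equivFin J
  have h := enorm_ampliation_le _ T (A.submatrix ((Equiv.refl ι).prodCongr e.symm)
    ((Equiv.refl ι).prodCongr e.symm))
  have h2 : (Matrix.of fun x y : κ × J =>
      T (Matrix.of fun i j => A (i, x.2) (j, y.2)) x.1 y.1) =
      (ampliation _ T (A.submatrix ((Equiv.refl ι).prodCongr e.symm)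
        ((Equiv.refl ι).prodCongr e.symm))).submatrix ((Equiv.refl κ).prodCongr e)
        ((Equiv.refl κ).prodCongr e) := by
    ext x y
    simp [ampliation]
  rw [h2, ← ofReal_norm, norm_submatrix_equiv, ofReal_norm]
  refine h.trans_eq ?_
  rw [← ofReal_norm, norm_submatrix_equiv, ofReal_norm]

theorem cbNorm_le_of_forall {T : Matrix ι ι ℂ →ₗ[ℂ] Matrix κ κ ℂ} {C : ℝ≥0∞}
    (h : ∀ k A, ‖ampliation k T A‖ₑ ≤ C * ‖A‖ₑ) : cbNorm T ≤ C := by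
  refine iSup_le fun k => iSup_le fun A => iSup_le fun hA => (h k A).trans ?_
  refine mul_le_of_le_one_right' ?_
  rw [← ofReal_norm]
  exact ENNReal.ofReal_le_one.2 hA

theorem cbNorm_comp_le (S : Matrix κ κ ℂ →ₗ[ℂ] Matrix ι' ι' ℂ)
    (T : Matrix ι ι ℂ →ₗ[ℂ] Matrix κ κ ℂ) : cbNorm (S ∘ₗ T) ≤ cbNorm S * cbNorm T :=
  cbNorm_le_of_forall fun k A => by
    rw [ampliation_comp, mul_assoc]
    exact (enorm_ampliation_le k S _).trans (by gcongr; exact enorm_ampliation_le k T A)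

theorem cbNorm_sum_le {s : Finset J} (T : J → Matrix ι ι ℂ →ₗ[ℂ] Matrix κ κ ℂ) :
    cbNorm (∑ i ∈ s, T i) ≤ ∑ i ∈ s, cbNorm (T i) := by
  refine cbNorm_le_of_forall fun k A => ?_
  have h : ampliation k (∑ i ∈ s, T i) A = ∑ i ∈ s, ampliation k (T i) A := by
    ext x y
    simp [ampliation, Matrix.sum_apply, LinearMap.sum_apply]
  rw [h, Finset.sum_mul]
  exact (enorm_sum_le _ _).trans (Finset.sum_le_sum fun i _ => enorm_ampliation_le k _ A)

theorem IsChannel.cbNorm_le_one {T : Matrix ι ι ℂ →ₗ[ℂ] Matrix κ κ ℂ} (hT : IsChannel T) :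
    cbNorm T ≤ 1 := by
  obtain ⟨K, hK⟩ := hT.1.exists_kraus
  refine cbNorm_le_of_forall fun k A => ?_
  rw [one_mul, ampliation_kraus k T K hK, ← ofReal_norm, ← ofReal_norm]
  refine ENNReal.ofReal_le_ofReal (norm_sum_conjTranspose_mul_mul_le _ ?_ A)
  have h1 : ∑ l, (K l)ᴴ * K l = 1 := by simpa [hT.2] using (hK 1).symm
  simp only [conjTranspose_kronecker, ← mul_kronecker_mul, conjTranspose_one, one_mul]
  rw [← one_kronecker_one, ← h1]
  ext x y
  simp [Matrix.sum_apply, Finset.sum_mul]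

/-- Pre- and postprocessing by channels does not increase the norm of complete boundedness. -/
theorem cbNorm_comp_comp_le {E : Matrix κ κ ℂ →ₗ[ℂ] Matrix κ' κ' ℂ}
    {D : Matrix ι' ι' ℂ →ₗ[ℂ] Matrix ι ι ℂ} (hE : IsChannel E) (hD : IsChannel D)
    (T : Matrix ι ι ℂ →ₗ[ℂ] Matrix κ κ ℂ) : cbNorm (E ∘ₗ T ∘ₗ D) ≤ cbNorm T :=
  calc cbNorm (E ∘ₗ T ∘ₗ D) ≤ cbNorm E * (cbNorm T * cbNorm D) :=
        (cbNorm_comp_le _ _).trans (by gcongr; exact cbNorm_comp_le _ _)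
    _ ≤ 1 * (cbNorm T * 1) := by
        gcongr
        · exact hE.cbNorm_le_one
        · exact hD.cbNorm_le_one
    _ = cbNorm T := by simp

end CbNorm

/-! ### Tensor products of maps -/

section TensorMap

variable {ι κ ι' I : Type*} [Fintype ι] [DecidableEq ι] [Fintype κ] [DecidableEq κ]
  [Fintype ι'] [DecidableEq ι'] [Fintype I] [DecidableEq I]

/-- The product operator `⊗ᵢ A i`. -/
def pureTensor (A : I → Matrix ι κ ℂ) : Matrix (I → ι) (I → κ) ℂ :=
  Matrix.of fun u v => ∏ i, A i (u i) (v i)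

theorem pureTensor_apply (A : I → Matrix ι κ ℂ) (u : I → ι) (v : I → κ) :
    pureTensor A u v = ∏ i, A i (u i) (v i) := rfl

theorem pureTensor_mul (A : I → Matrix ι κ ℂ) (B : I → Matrix κ ι' ℂ) :
    pureTensor A * pureTensor B = pureTensor fun i => A i * B i := by
  ext u v
  simp only [Matrix.mul_apply, pureTensor_apply, ← Finset.prod_mul_distrib]
  rw [Finset.prod_univ_sum, Fintype.piFinset_univ]

theorem pureTensor_conjTranspose (A : I → Matrix ι κ ℂ) :
    (pureTensor A)ᴴ = pureTensor fun i => (A i)ᴴ := by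
  ext u v
  simp [pureTensor_apply]

theorem pureTensor_one : pureTensor (fun _ : I => (1 : Matrix ι ι ℂ)) = 1 := by
  ext u v
  rw [pureTensor_apply]
  by_cases h : u = v
  · subst h
    simp
  · obtain ⟨i, hi⟩ := Function.ne_iff.1 h
    rw [Matrix.one_apply_ne h]
    exact Finset.prod_eq_zero (Finset.mem_univ i) (Matrix.one_apply_ne hi)

theorem single_eq_pureTensor (u : I → ι) (v : I → κ) :
    Matrix.single u v (1 : ℂ) = pureTensor fun i => Matrix.single (u i) (v i) 1 := by
  ext x y
  rw [pureTensor_apply]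
  simp only [Matrix.single_apply, funext_iff, Finset.prod_ite_zero, Finset.prod_const_one,
    ← forall_and]
  simp

theorem linearMap_ext_single {M : Type*} [AddCommGroup M] [Module ℂ M]
    {f g : Matrix ι ι ℂ →ₗ[ℂ] M}
    (h : ∀ u v, f (Matrix.single u v 1) = g (Matrix.single u v 1)) : f = g := by
  refine LinearMap.ext fun X => ?_
  have h2 : ∀ u v, Matrix.single u v (X u v) = X u v • Matrix.single u v (1 : ℂ) := by
    intro u v
    simp [Matrix.smul_single]
  rw [Matrix.matrix_eq_sum_single X]
  simp only [map_sum, h2, map_smul, h]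

/-- Product operators span: a linear map is determined by its values on them. -/
theorem linearMap_ext_pureTensor {M : Type*} [AddCommGroup M] [Module ℂ M]
    {f g : Matrix (I → ι) (I → ι) ℂ →ₗ[ℂ] M} (h : ∀ A, f (pureTensor A) = g (pureTensor A)) :
    f = g :=
  linearMap_ext_single fun u v => by rw [single_eq_pureTensor, h]

/-- The tensor product `⊗ᵢ S i` of maps, given by its values on the products of matrix units. -/
def tensorMap (S : I → Matrix ι ι ℂ →ₗ[ℂ] Matrix κ κ ℂ) :
    Matrix (I → ι) (I → ι) ℂ →ₗ[ℂ] Matrix (I → κ) (I → κ) ℂ where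
  toFun A := Matrix.of fun x y =>
    ∑ u : I → ι, ∑ v : I → ι, A u v * ∏ i, S i (Matrix.single (u i) (v i) 1) (x i) (y i)
  map_add' A B := by
    ext x y
    simp [add_mul, Finset.sum_add_distrib]
  map_smul' c A := by
    ext x y
    simp [Finset.mul_sum, mul_assoc]

theorem tensorPower_eq_tensorMap (T : Matrix ι ι ℂ →ₗ[ℂ] Matrix κ κ ℂ) (n : ℕ) :
    tensorPower T n = tensorMap fun _ => T := rfl

theorem apply_eq_sum_single (T : Matrix ι ι ℂ →ₗ[ℂ] Matrix κ κ ℂ) (A : Matrix ι ι ℂ) (x y : κ) :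
    T A x y = ∑ p : ι × ι, A p.1 p.2 * T (Matrix.single p.1 p.2 1) x y := by
  conv_lhs => rw [Matrix.matrix_eq_sum_single A]
  rw [Fintype.sum_prod_type]
  simp only [map_sum, Matrix.sum_apply]
  refine Finset.sum_congr rfl fun a _ => Finset.sum_congr rfl fun b _ => ?_
  have : Matrix.single a b (A a b) = A a b • Matrix.single a b (1 : ℂ) := by
    simp [Matrix.smul_single]
  rw [this, map_smul]
  rfl

theorem tensorMap_pureTensor (S : I → Matrix ι ι ℂ →ₗ[ℂ] Matrix κ κ ℂ) (A : I → Matrix ι ι ℂ) :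
    tensorMap S (pureTensor A) = pureTensor fun i => S i (A i) := by
  ext x y
  simp only [tensorMap, LinearMap.coe_mk, AddHom.coe_mk, Matrix.of_apply, pureTensor_apply]
  simp_rw [apply_eq_sum_single (S _) (A _)]
  rw [Finset.prod_univ_sum, Fintype.piFinset_univ, ← Fintype.sum_prod_type']
  refine (Fintype.sum_equiv (Equiv.arrowProdEquivProdArrow I (fun _ => ι) (fun _ => ι))
    _ _ ?_).symm
  intro p
  simp [Equiv.arrowProdEquivProdArrow, Finset.prod_mul_distrib]

theorem IsChannel.tensorPower {T : Matrix ι ι ℂ →ₗ[ℂ] Matrix κ κ ℂ} (hT : IsChannel T) (n : ℕ) :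
    IsChannel (tensorPower T n) := by
  obtain ⟨K, hK⟩ := hT.1.exists_kraus
  refine ⟨isCompletelyPositive_of_kraus
    (fun l : Fin n → κ × Fin (Fintype.card ι) => pureTensor fun i => K (l i)) fun X => ?_, ?_⟩
  · have h : QuantumChannel.tensorPower T n =
        ∑ l : Fin n → κ × Fin (Fintype.card ι), compression (pureTensor fun i => K (l i)) := by
      refine linearMap_ext_pureTensor fun A => ?_
      rw [tensorPower_eq_tensorMap, tensorMap_pureTensor, LinearMap.sum_apply]
      simp only [compression_apply, pureTensor_conjTranspose, pureTensor_mul]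
      ext x y
      simp only [pureTensor_apply, Matrix.sum_apply, hK]
      rw [Finset.prod_univ_sum, Fintype.piFinset_univ]
    rw [h, LinearMap.sum_apply]
    rfl
  · rw [← pureTensor_one, tensorPower_eq_tensorMap, tensorMap_pureTensor]
    simp only [hT.2, pureTensor_one]

/-- Binomial expansion of a tensor product of sums. -/
theorem tensorMap_add (S R : Matrix ι ι ℂ →ₗ[ℂ] Matrix κ κ ℂ) :
    tensorMap (fun _ : I => S + R) =
      ∑ s : Finset I, tensorMap fun i => if i ∈ s then S else R := by
  refine linearMap_ext_pureTensor fun A => ?_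
  rw [LinearMap.sum_apply]
  simp only [tensorMap_pureTensor]
  ext x y
  simp only [pureTensor_apply, Matrix.sum_apply, LinearMap.add_apply, Matrix.add_apply]
  rw [Finset.prod_add, Finset.powerset_univ]
  refine Finset.sum_congr rfl fun s _ => ?_
  rw [← Finset.prod_mul_prod_compl s (fun i => ((if i ∈ s then S else R) (A i)) (x i) (y i)),
    Finset.compl_eq_univ_sdiff]
  refine congrArg₂ _ (Finset.prod_congr rfl fun i hi => by rw [if_pos hi])
    (Finset.prod_congr rfl fun i hi => by rw [if_neg (Finset.mem_sdiff.1 hi).2])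

end TensorMap

/-! ### Maps acting on one tensor factor -/

section SiteMap

variable {ι I : Type*} [Fintype ι] [DecidableEq ι] [Fintype I] [DecidableEq I]

/-- The map acting as `S` on the tensor factor `i` and as the identity on the others. -/
def siteMap (i : I) (S : Matrix ι ι ℂ →ₗ[ℂ] Matrix ι ι ℂ) :
    Matrix (I → ι) (I → ι) ℂ →ₗ[ℂ] Matrix (I → ι) (I → ι) ℂ where
  toFun A := Matrix.of fun x y =>
    S (Matrix.of fun p q => A (Function.update x i p) (Function.update y i q)) (x i) (y i)
  map_add' A B := by
    ext x y
    exact congrFun₂ (map_add S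
      (Matrix.of fun p q => A (Function.update x i p) (Function.update y i q))
      (Matrix.of fun p q => B (Function.update x i p) (Function.update y i q))) (x i) (y i)
  map_smul' c A := by
    ext x y
    exact congrFun₂ (map_smul S c
      (Matrix.of fun p q => A (Function.update x i p) (Function.update y i q))) (x i) (y i)

theorem siteMap_pureTensor (i : I) (S : Matrix ι ι ℂ →ₗ[ℂ] Matrix ι ι ℂ)
    (A : I → Matrix ι ι ℂ) :
    siteMap i S (pureTensor A) = pureTensor (Function.update A i (S (A i))) := by
  ext x y
  simp only [siteMap, LinearMap.coe_mk, AddHom.coe_mk, Matrix.of_apply]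
  have h : (Matrix.of fun p q => pureTensor A (Function.update x i p) (Function.update y i q)) =
      (∏ j ∈ Finset.univ.erase i, A j (x j) (y j)) • A i := by
    ext p q
    rw [Matrix.of_apply, pureTensor_apply, ← Finset.prod_erase_mul _ _ (Finset.mem_univ i)]
    simp only [Function.update_self, Matrix.smul_apply, smul_eq_mul]
    congr 1
    refine Finset.prod_congr rfl fun j hj => ?_
    rw [Function.update_of_ne (Finset.ne_of_mem_erase hj),
      Function.update_of_ne (Finset.ne_of_mem_erase hj)]
  rw [h, map_smul, pureTensor_apply, ← Finset.prod_erase_mul _ _ (Finset.mem_univ i)]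
  simp only [Function.update_self, Matrix.smul_apply, smul_eq_mul]
  congr 1
  refine Finset.prod_congr rfl fun j hj => ?_
  rw [Function.update_of_ne (Finset.ne_of_mem_erase hj)]

theorem cbNorm_siteMap_le (i : I) (S : Matrix ι ι ℂ →ₗ[ℂ] Matrix ι ι ℂ) :
    cbNorm (siteMap i S) ≤ cbNorm S := by
  refine cbNorm_le_of_forall fun k A => ?_
  let e : (I → ι) × Fin k ≃ ι × (({j // j ≠ i} → ι) × Fin k) :=
    ((Equiv.funSplitAt i ι).prodCongr (Equiv.refl _)).trans (Equiv.prodAssoc _ _ _)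
  have he : ∀ (x : (I → ι) × Fin k) (p : ι),
      e.symm (p, (e x).2) = (Function.update x.1 i p, x.2) := by
    intro x p
    refine Prod.ext (funext fun j => ?_) rfl
    by_cases hj : j = i
    · subst hj
      simp [e, Equiv.funSplitAt, Equiv.piSplitAt]
    · simp [e, Equiv.funSplitAt, Equiv.piSplitAt, hj]
  have h := enorm_blocks_le S (A.submatrix e.symm e.symm)
  have h2 : ampliation k (siteMap i S) A =
      (Matrix.of fun x y : ι × (({j // j ≠ i} → ι) × Fin k) =>
        S (Matrix.of fun p q => (A.submatrix e.symm e.symm) (p, x.2) (q, y.2)) x.1 y.1).submatrix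
          e e := by
    ext x y
    simp only [Matrix.submatrix_apply, Matrix.of_apply, he]
    rfl
  rw [h2, ← ofReal_norm, norm_submatrix_equiv, ofReal_norm]
  refine h.trans_eq ?_
  rw [← ofReal_norm, norm_submatrix_equiv, ofReal_norm]

theorem tensorMap_ite_insert {i : I} {s : Finset I} (hi : i ∉ s)
    (S : Matrix ι ι ℂ →ₗ[ℂ] Matrix ι ι ℂ) :
    tensorMap (fun j => if j ∈ insert i s then S else LinearMap.id) =
      siteMap i S ∘ₗ tensorMap fun j => if j ∈ s then S else LinearMap.id := by
  refine linearMap_ext_pureTensor fun A => ?_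
  rw [LinearMap.comp_apply, tensorMap_pureTensor, tensorMap_pureTensor, siteMap_pureTensor]
  congr 1
  funext j
  by_cases hj : j = i
  · subst hj
    simp [hi]
  · simp [hj, Function.update_of_ne]

theorem tensorMap_ite_empty (S : Matrix ι ι ℂ →ₗ[ℂ] Matrix ι ι ℂ) :
    tensorMap (fun j : I => if j ∈ (∅ : Finset I) then S else LinearMap.id) = LinearMap.id :=
  linearMap_ext_pureTensor fun A => by rw [tensorMap_pureTensor]; simp

theorem isChannel_id : IsChannel (LinearMap.id : Matrix ι ι ℂ →ₗ[ℂ] Matrix ι ι ℂ) :=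
  isChannel_of_kraus (fun _ : Unit => 1) (fun X => by simp) (by simp)

theorem cbNorm_tensorMap_ite_le (S : Matrix ι ι ℂ →ₗ[ℂ] Matrix ι ι ℂ) (s : Finset I) :
    cbNorm (tensorMap fun j => if j ∈ s then S else LinearMap.id) ≤ cbNorm S ^ s.card := by
  induction s using Finset.induction_on with
  | empty =>
    rw [tensorMap_ite_empty]
    simpa using isChannel_id.cbNorm_le_one
  | insert i s hi ih =>
    rw [tensorMap_ite_insert hi, Finset.card_insert_of_notMem hi, pow_succ']
    exact (cbNorm_comp_le _ _).trans (mul_le_mul' (cbNorm_siteMap_le i S) ih)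

end SiteMap

/-! ### Operators and maps acting on few tensor factors -/

section LocalOperators

variable {ι I : Type*} [Fintype ι] [DecidableEq ι] [Fintype I] [DecidableEq I]

open scoped Classical in
/-- The span of the product operators that differ from the identity in at most `f` tensor
factors; it contains every operator acting on at most `f` factors. -/
def localOperators (ι I : Type*) [Fintype ι] [DecidableEq ι] [Fintype I] (f : ℕ) :
    Submodule ℂ (Matrix (I → ι) (I → ι) ℂ) :=
  Submodule.span ℂ {F | ∃ A : I → Matrix ι ι ℂ,
    (Finset.univ.filter fun i => A i ≠ 1).card ≤ f ∧ F = pureTensor A}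

open scoped Classical in
theorem mul_mem_localOperators {f g : ℕ} {F G : Matrix (I → ι) (I → ι) ℂ}
    (hF : F ∈ localOperators ι I f) (hG : G ∈ localOperators ι I g) :
    F * G ∈ localOperators ι I (f + g) := by
  induction hF using Submodule.span_induction with
  | zero => simp
  | add _ _ _ _ h1 h2 => rw [Matrix.add_mul]; exact add_mem h1 h2
  | smul c _ _ h => rw [Matrix.smul_mul]; exact Submodule.smul_mem _ _ h
  | mem F hF =>
    obtain ⟨A, hA, rfl⟩ := hF
    induction hG using Submodule.span_induction with
    | zero => simp
    | add _ _ _ _ h1 h2 => rw [Matrix.mul_add]; exact add_mem h1 h2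
    | smul c _ _ h => rw [Matrix.mul_smul]; exact Submodule.smul_mem _ _ h
    | mem G hG =>
      obtain ⟨B, hB, rfl⟩ := hG
      refine Submodule.subset_span ⟨_, ?_, pureTensor_mul A B⟩
      refine (Finset.card_le_card ?_).trans ((Finset.card_union_le _ _).trans (add_le_add hA hB))
      intro i
      simp only [Finset.mem_filter, Finset.mem_univ, true_and, Finset.mem_union]
      contrapose!
      rintro ⟨h1, h2⟩
      rw [h1, h2, one_mul]

theorem conjTranspose_mem_localOperators {f : ℕ} {F : Matrix (I → ι) (I → ι) ℂ}
    (hF : F ∈ localOperators ι I f) : Fᴴ ∈ localOperators ι I f := by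
  induction hF using Submodule.span_induction with
  | zero => simp
  | add _ _ _ _ h1 h2 => rw [conjTranspose_add]; exact add_mem h1 h2
  | smul c _ _ h => rw [conjTranspose_smul]; exact Submodule.smul_mem _ _ h
  | mem F hF =>
    obtain ⟨A, hA, rfl⟩ := hF
    refine Submodule.subset_span ⟨_, le_trans (le_of_eq ?_) hA, pureTensor_conjTranspose A⟩
    congr 1
    ext i
    simp [conjTranspose_eq_one]

theorem one_mem_localOperators (f : ℕ) : (1 : Matrix (I → ι) (I → ι) ℂ) ∈ localOperators ι I f :=
  Submodule.subset_span ⟨fun _ => 1, by simp, pureTensor_one.symm⟩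

theorem localOperators_mono {f g : ℕ} (h : f ≤ g) : localOperators ι I f ≤ localOperators ι I g :=
  Submodule.span_mono fun _ ⟨A, hA, hF⟩ => ⟨A, hA.trans h, hF⟩

/-- The span of the maps `X ↦ Fᴴ X G` with `F` and `G` local on at most `f` tensor factors. -/
def localMaps (ι I : Type*) [Fintype ι] [DecidableEq ι] [Fintype I] [DecidableEq I] (f : ℕ) :
    Submodule ℂ (Matrix (I → ι) (I → ι) ℂ →ₗ[ℂ] Matrix (I → ι) (I → ι) ℂ) :=
  Submodule.span ℂ {Φ | ∃ F ∈ localOperators ι I f, ∃ G ∈ localOperators ι I f,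
    ∀ X, Φ X = Fᴴ * X * G}

theorem comp_mem_localMaps {f g : ℕ}
    {Φ Ψ : Matrix (I → ι) (I → ι) ℂ →ₗ[ℂ] Matrix (I → ι) (I → ι) ℂ}
    (hΦ : Φ ∈ localMaps ι I f) (hΨ : Ψ ∈ localMaps ι I g) : Φ ∘ₗ Ψ ∈ localMaps ι I (f + g) := by
  induction hΦ using Submodule.span_induction with
  | zero => simp
  | add _ _ _ _ h1 h2 => rw [LinearMap.add_comp]; exact add_mem h1 h2
  | smul c _ _ h => rw [LinearMap.smul_comp]; exact Submodule.smul_mem _ _ h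
  | mem Φ hΦ =>
    obtain ⟨F, hF, G, hG, h⟩ := hΦ
    induction hΨ using Submodule.span_induction with
    | zero => simp
    | add _ _ _ _ h1 h2 => rw [LinearMap.comp_add]; exact add_mem h1 h2
    | smul c _ _ h => rw [LinearMap.comp_smul]; exact Submodule.smul_mem _ _ h
    | mem Ψ hΨ =>
      obtain ⟨F', hF', G', hG', h'⟩ := hΨ
      refine Submodule.subset_span ⟨F' * F, ?_, G' * G, ?_, fun X => ?_⟩
      · rw [add_comm]
        exact mul_mem_localOperators hF' hF
      · rw [add_comm]
        exact mul_mem_localOperators hG' hG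
      · simp [h, h', Matrix.mul_assoc]

/-- A linear map of matrices is a combination of the maps `X ↦ E X E'` with `E`, `E'` matrix
units, so acting on one tensor factor is a local map. -/
theorem siteMap_mem_localMaps (i : I) (S : Matrix ι ι ℂ →ₗ[ℂ] Matrix ι ι ℂ) :
    siteMap i S ∈ localMaps ι I 1 := by
  classical
  let L : Matrix ι ι ℂ → Matrix (I → ι) (I → ι) ℂ := fun E =>
    pureTensor (Function.update (fun _ => 1) i E)
  have hL : ∀ E, L E ∈ localOperators ι I 1 := by
    intro E
    refine Submodule.subset_span ⟨_, ?_, rfl⟩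
    refine (Finset.card_le_card (t := {i}) ?_).trans (by simp)
    intro j
    simp only [Finset.mem_filter, Finset.mem_univ, true_and, Finset.mem_singleton]
    contrapose!
    intro hj
    simp [Function.update_of_ne hj]
  let M (p q : ι × ι) : Matrix (I → ι) (I → ι) ℂ →ₗ[ℂ] Matrix (I → ι) (I → ι) ℂ :=
    { toFun := fun X => (L (Matrix.single p.1 q.1 1))ᴴ * X * L (Matrix.single p.2 q.2 1)
      map_add' := fun X Y => by simp [Matrix.mul_add, Matrix.add_mul]
      map_smul' := fun c X => by simp }
  have hM : ∀ p q, M p q ∈ localMaps ι I 1 := fun p q =>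
    Submodule.subset_span ⟨_, hL _, _, hL _, fun _ => rfl⟩
  have h : siteMap i S = ∑ p : ι × ι, ∑ q : ι × ι,
      S (Matrix.single p.1 p.2 1) q.1 q.2 • M p q := by
    refine linearMap_ext_pureTensor fun A => ?_
    rw [siteMap_pureTensor]
    ext x y
    simp only [LinearMap.sum_apply, Matrix.sum_apply, LinearMap.smul_apply, Matrix.smul_apply, M,
      LinearMap.coe_mk, AddHom.coe_mk, L, pureTensor_conjTranspose, pureTensor_mul,
      pureTensor_apply]
    have h2 : ∀ p q : ι × ι, ∏ j, ((Function.update (fun _ => (1 : Matrix ι ι ℂ)) i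
        (Matrix.single p.1 q.1 1) j)ᴴ * A j * Function.update (fun _ => (1 : Matrix ι ι ℂ)) i
        (Matrix.single p.2 q.2 1) j) (x j) (y j) =
        (∏ j ∈ Finset.univ.erase i, A j (x j) (y j)) *
          (if q.1 = x i then if q.2 = y i then A i p.1 p.2 else 0 else 0) := by
      intro p q
      rw [← Finset.prod_erase_mul _ _ (Finset.mem_univ i)]
      congr 1
      · refine Finset.prod_congr rfl fun j hj => ?_
        simp [Function.update_of_ne (Finset.ne_of_mem_erase hj)]
      · simp only [Function.update_self, Matrix.mul_apply, Matrix.single_apply, ite_and,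
          conjTranspose_apply, apply_ite star, star_one, star_zero, ite_mul, mul_ite, one_mul,
          mul_one, zero_mul, mul_zero, Finset.sum_ite_eq, Finset.mem_univ, if_true]
        split_ifs <;> rfl
    simp only [h2]
    rw [← Finset.prod_erase_mul _ _ (Finset.mem_univ i)]
    have h3 : ∏ j ∈ Finset.univ.erase i, Function.update A i (S (A i)) j (x j) (y j) =
        ∏ j ∈ Finset.univ.erase i, A j (x j) (y j) :=
      Finset.prod_congr rfl fun j hj => by
        rw [Function.update_of_ne (Finset.ne_of_mem_erase hj)]
    rw [h3, Function.update_self, apply_eq_sum_single, Finset.mul_sum]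
    refine Finset.sum_congr rfl fun p _ => ?_
    simp only [Fintype.sum_prod_type, smul_eq_mul, mul_ite, mul_zero, Finset.sum_ite_eq',
      Finset.mem_univ, if_true, Finset.sum_ite_irrel, Finset.sum_const_zero]
    ring
  rw [h]
  exact Submodule.sum_mem _ fun p _ => Submodule.sum_mem _ fun q _ =>
    Submodule.smul_mem _ _ (hM p q)

theorem tensorMap_ite_mem_localMaps (S : Matrix ι ι ℂ →ₗ[ℂ] Matrix ι ι ℂ) (s : Finset I) :
    tensorMap (fun j => if j ∈ s then S else LinearMap.id) ∈ localMaps ι I s.card := by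
  induction s using Finset.induction_on with
  | empty =>
    rw [tensorMap_ite_empty]
    exact Submodule.subset_span ⟨1, one_mem_localOperators _, 1, one_mem_localOperators _,
      fun X => by simp⟩
  | insert i s hi ih =>
    rw [tensorMap_ite_insert hi, Finset.card_insert_of_notMem hi, add_comm]
    exact comp_mem_localMaps (siteMap_mem_localMaps i S) ih

theorem localMaps_mono {f g : ℕ} (h : f ≤ g) : localMaps ι I f ≤ localMaps ι I g :=
  Submodule.span_mono fun _ ⟨F, hF, G, hG, hΦ⟩ =>
    ⟨F, localOperators_mono h hF, G, localOperators_mono h hG, hΦ⟩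

end LocalOperators

/-! ### Decoding under a Knill–Laflamme condition -/

section Decoder

variable {Y S : Type*} [Fintype Y] [DecidableEq Y] [Fintype S] [DecidableEq S]

/-- The trace, normalised to be `1` at the identity. -/
noncomputable def normalizedTrace (Y : Type*) [Fintype Y] : Matrix Y Y ℂ →ₗ[ℂ] ℂ :=
  (Fintype.card Y : ℂ)⁻¹ • Matrix.traceLinearMap Y ℂ ℂ

theorem normalizedTrace_apply (F : Matrix Y Y ℂ) :
    normalizedTrace Y F = (Fintype.card Y : ℂ)⁻¹ * F.trace := rfl

theorem normalizedTrace_one [Nonempty Y] : normalizedTrace Y 1 = 1 := by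
  rw [normalizedTrace_apply, Matrix.trace_one]
  exact inv_mul_cancel₀ (Nat.cast_ne_zero.2 Fintype.card_ne_zero)

/-- Every space of operators has an orthonormal basis for the inner product given by the
normalised trace. -/
theorem exists_orthonormal_operators [Nonempty Y] (W : Submodule ℂ (Matrix Y Y ℂ)) :
    ∃ (r : ℕ) (F : Fin r → Matrix Y Y ℂ), (∀ i, F i ∈ W) ∧
      (∀ i j, normalizedTrace Y ((F i)ᴴ * F j) = if i = j then 1 else 0) ∧
      ∀ G ∈ W, G = ∑ i, normalizedTrace Y ((F i)ᴴ * G) • F i := by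
  -- The basis is transported from `ℂ^(Y × Y)`, whose inner product is the unnormalised trace.
  let φ : Matrix Y Y ℂ →ₗ[ℂ] EuclideanSpace ℂ (Y × Y) :=
    { toFun := fun G => WithLp.toLp 2 fun p => G p.1 p.2
      map_add' := fun _ _ => rfl
      map_smul' := fun _ _ => rfl }
  have hφ : Function.Injective φ := by
    intro G H h
    ext x y
    exact congrArg (fun v : EuclideanSpace ℂ (Y × Y) => v (x, y)) h
  have hin : ∀ G H, inner ℂ (φ G) (φ H) = (Gᴴ * H).trace := by
    intro G H
    simp only [PiLp.inner_apply, Matrix.trace, Matrix.diag_apply, Matrix.mul_apply,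
      conjTranspose_apply, Fintype.sum_prod_type_right]
    exact Finset.sum_congr rfl fun _ _ => Finset.sum_congr rfl fun _ _ => mul_comm _ _
  let b := stdOrthonormalBasis ℂ (W.map φ)
  have hb : ∀ i, ∃ G ∈ W, φ G = b i := fun i => (b i).2
  choose H hHW hH using hb
  let N : ℝ := Fintype.card Y
  have hN : 0 < N := Nat.cast_pos.2 Fintype.card_pos
  let c : ℂ := (Real.sqrt N : ℝ)
  have hc : c * c = Fintype.card Y := by
    simp only [c, ← Complex.ofReal_mul, Real.mul_self_sqrt hN.le]
    simp [N]
  have hc' : (starRingEnd ℂ) c = c := Complex.conj_ofReal _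
  have hY : (Fintype.card Y : ℂ) ≠ 0 := by simp
  refine ⟨_, fun i => c • H i, fun i => W.smul_mem _ (hHW i), fun i j => ?_, fun G hG => ?_⟩
  · have h1 := orthonormal_iff_ite.1 b.orthonormal i j
    rw [Submodule.coe_inner, ← hH, ← hH, hin] at h1
    rw [normalizedTrace_apply, conjTranspose_smul, smul_mul_smul_comm, trace_smul, h1]
    rw [Complex.star_def, hc', hc, smul_eq_mul, ← mul_assoc, inv_mul_cancel₀ hY, one_mul]
  · apply hφ
    have h1 := b.sum_repr' ⟨φ G, Submodule.mem_map_of_mem hG⟩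
    have h2 := congrArg Subtype.val h1
    rw [Submodule.coe_sum] at h2
    rw [map_sum]
    refine h2.symm.trans (Finset.sum_congr rfl fun i _ => ?_)
    rw [Submodule.coe_smul, Submodule.coe_inner, ← hH, hin, map_smul, map_smul, smul_smul]
    congr 1
    rw [normalizedTrace_apply, conjTranspose_smul, smul_mul, trace_smul, Complex.star_def, hc',
      smul_eq_mul]
    field_simp
    linear_combination (-((H i)ᴴ * G).trace) * hc

/-- The Knill–Laflamme theorem for codes `V` on which the error operators act like their
normalised trace: with `Fᵢ` an orthonormal basis of the errors, the `Fᵢ V` are isometries with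
orthogonal ranges, and the decoder undoes `Fᵢ` on the range of `Fᵢ V`. -/
theorem exists_decoder [Nonempty Y] [Nonempty S] (V : Matrix Y S ℂ)
    (W : Submodule ℂ (Matrix Y Y ℂ))
    (hV : ∀ F ∈ W, ∀ G ∈ W, Vᴴ * (Fᴴ * G) * V = normalizedTrace Y (Fᴴ * G) • 1) :
    ∃ D : Matrix S S ℂ →ₗ[ℂ] Matrix Y Y ℂ, IsChannel D ∧ ∀ X, ∀ F ∈ W, ∀ G ∈ W,
      Vᴴ * (Fᴴ * D X * G) * V = normalizedTrace Y (Fᴴ * G) • X := by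
  obtain ⟨r, F, hFW, hF, hspan⟩ := exists_orthonormal_operators W
  let s₀ : S := Classical.arbitrary S
  let B : Fin r → Matrix Y S ℂ := fun i => F i * V
  have hBB : ∀ i j, (B i)ᴴ * B j = if i = j then 1 else 0 := by
    intro i j
    have h := hV _ (hFW i) _ (hFW j)
    rw [hF] at h
    simp only [B, conjTranspose_mul]
    rw [show Vᴴ * (F i)ᴴ * (F j * V) = Vᴴ * ((F i)ᴴ * F j) * V by simp only [Matrix.mul_assoc], h]
    split_ifs <;> simp
  let P : Matrix Y Y ℂ := ∑ i, B i * (B i)ᴴ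
  have hPH : Pᴴ = P := by
    simp [P, conjTranspose_sum]
  have hPB : ∀ j, P * B j = B j := by
    intro j
    simp only [P, Matrix.sum_mul, Matrix.mul_assoc, hBB]
    rw [Finset.sum_eq_single j (fun i _ hij => by rw [if_neg hij, Matrix.mul_zero]) (by simp),
      if_pos rfl, Matrix.mul_one]
  have hPP : P * P = P := by
    change P * (∑ i, B i * (B i)ᴴ) = ∑ i, B i * (B i)ᴴ
    rw [Matrix.mul_sum]
    exact Finset.sum_congr rfl fun i _ => by rw [← Matrix.mul_assoc, hPB]
  have hQ : (1 - P)ᴴ * (1 - P) = 1 - P := by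
    rw [conjTranspose_sub, conjTranspose_one, hPH, Matrix.mul_sub, Matrix.sub_mul,
      Matrix.sub_mul, hPP]
    simp
  -- The second family of Kraus operators prepares `s₀` off the ranges of the `Fᵢ V`.
  let K : Fin r ⊕ Y → Matrix S Y ℂ := Sum.elim (fun i => (B i)ᴴ)
    fun y => Matrix.of fun s y' => if s = s₀ then (1 - P) y y' else 0
  have hK2 : ∀ X : Matrix S S ℂ, ∑ y, (K (Sum.inr y))ᴴ * X * K (Sum.inr y) =
      X s₀ s₀ • ((1 - P)ᴴ * (1 - P)) := by
    intro X
    ext y y'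
    simp only [K, Sum.elim_inr, Matrix.sum_apply, Matrix.mul_apply, conjTranspose_apply,
      Matrix.of_apply, Matrix.smul_apply, smul_eq_mul, Finset.mul_sum]
    refine Finset.sum_congr rfl fun z _ => ?_
    simp only [apply_ite star, star_zero, ite_mul, zero_mul, mul_ite, mul_zero,
      Finset.sum_ite_eq', Finset.mem_univ, if_true]
    ring
  let D : Matrix S S ℂ →ₗ[ℂ] Matrix Y Y ℂ := ∑ l, compression (K l)
  have hD : ∀ X, D X = ∑ l, (K l)ᴴ * X * K l := fun X => by
    simp only [D, LinearMap.sum_apply, compression_apply]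
  refine ⟨D, isChannel_of_kraus K hD ?_, fun X G hG H hH => ?_⟩
  · have h := hK2 1
    simp only [Matrix.mul_one, one_apply_eq, one_smul, hQ] at h
    rw [Fintype.sum_sum_type, h]
    simp [K, P]
  · have hBH : ∀ i, (B i)ᴴ * (H * V) = normalizedTrace Y ((F i)ᴴ * H) • 1 := by
      intro i
      rw [← hV _ (hFW i) _ hH]
      simp only [B, conjTranspose_mul, Matrix.mul_assoc]
    have hGB : ∀ i, Vᴴ * Gᴴ * B i = normalizedTrace Y (Gᴴ * F i) • 1 := by
      intro i
      rw [← hV _ hG _ (hFW i)]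
      simp only [B, Matrix.mul_assoc]
    have hPH' : (1 - P) * (H * V) = 0 := by
      rw [Matrix.sub_mul, Matrix.one_mul, sub_eq_zero]
      simp only [P, Matrix.sum_mul, Matrix.mul_assoc, hBH]
      conv_lhs => rw [hspan H hH]
      simp [B, Matrix.sum_mul]
    rw [hD, Fintype.sum_sum_type, hK2]
    have h1 : Vᴴ * (Gᴴ * (X s₀ s₀ • ((1 - P)ᴴ * (1 - P))) * H) * V = 0 := by
      simp only [Matrix.mul_smul, Matrix.smul_mul, Matrix.mul_assoc, hPH', Matrix.mul_zero,
        smul_zero]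
    rw [Matrix.mul_add, Matrix.add_mul, Matrix.mul_add, Matrix.add_mul, h1, add_zero]
    have h2 : ∀ i, Vᴴ * (Gᴴ * ((K (Sum.inl i))ᴴ * X * K (Sum.inl i)) * H) * V =
        (normalizedTrace Y ((F i)ᴴ * H) * normalizedTrace Y (Gᴴ * F i)) • X := by
      intro i
      have : Vᴴ * (Gᴴ * ((K (Sum.inl i))ᴴ * X * K (Sum.inl i)) * H) * V =
          (Vᴴ * Gᴴ * B i) * X * ((B i)ᴴ * (H * V)) := by
        simp [K, Matrix.mul_assoc]
      rw [this, hBH, hGB]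
      simp [smul_smul]
    simp only [Matrix.mul_sum, Matrix.sum_mul, h2, ← Finset.sum_smul]
    congr 1
    conv_rhs => rw [hspan H hH]
    simp [Matrix.mul_sum]

end Decoder

/-! ### Existence of linear codes -/

section CodeExistence

open scoped Classical in
theorem card_lowWeight_le (F : Type*) [Field F] [Fintype F] (n w : ℕ) :
    Fintype.card {v : Fin n → F // (Finset.univ.filter fun i => v i ≠ 0).card ≤ w} ≤
      2 ^ n * Fintype.card F ^ w := by
  rw [Fintype.card_subtype]
  let P : Finset (Finset (Fin n)) := Finset.univ.filter fun A => A.card ≤ w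
  let Z : Finset (Fin n) → Finset (Fin n → F) := fun A =>
    Fintype.piFinset fun i => if i ∈ A then Finset.univ else {0}
  have hsub : (Finset.univ.filter fun v : Fin n → F =>
      (Finset.univ.filter fun i => v i ≠ 0).card ≤ w) ⊆ P.biUnion Z := by
    intro v hv
    simp only [Finset.mem_filter, Finset.mem_univ, true_and] at hv
    refine Finset.mem_biUnion.2 ⟨Finset.univ.filter fun i => v i ≠ 0, by simpa [P] using hv, ?_⟩
    refine Fintype.mem_piFinset.2 fun i => ?_
    by_cases hi : v i = 0 <;> simp [hi]
  refine (Finset.card_le_card hsub).trans (Finset.card_biUnion_le.trans ?_)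
  have hq : 1 ≤ Fintype.card F := Fintype.card_pos
  calc ∑ A ∈ P, (Z A).card ≤ ∑ A ∈ P, Fintype.card F ^ w := by
        refine Finset.sum_le_sum fun A hA => ?_
        rw [Fintype.card_piFinset]
        have : ∀ i, (if i ∈ A then (Finset.univ : Finset F) else {0}).card =
            if i ∈ A then Fintype.card F else 1 := by
          intro i
          split_ifs <;> simp
        simp only [this, Finset.prod_ite_mem, Finset.univ_inter, Finset.prod_const]
        exact Nat.pow_le_pow_right hq (by simpa [P] using hA)
    _ ≤ 2 ^ n * Fintype.card F ^ w := by
        rw [Finset.sum_const, smul_eq_mul]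
        gcongr
        exact (Finset.card_le_univ _).trans (by simp)

/-- All fibres of a surjective linear map of finite spaces have the same size. -/
theorem card_fiber_mul_card {F M N : Type*} [Field F] [AddCommGroup M] [Module F M] [Fintype M]
    [AddCommGroup N] [Module F N] [Fintype N] [DecidableEq N] (φ : M →ₗ[F] N)
    (hφ : Function.Surjective φ) (y : N) :
    (Finset.univ.filter fun x => φ x = y).card * Fintype.card N = Fintype.card M := by
  have h := Finset.card_eq_sum_card_fiberwise (f := φ) (s := Finset.univ) (t := Finset.univ)
    (fun _ _ => Finset.mem_coe.2 (Finset.mem_univ _))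
  have h2 : ∀ z ∈ (Finset.univ : Finset N), (Finset.univ.filter fun x => φ x = z).card =
      (Finset.univ.filter fun x => φ x = y).card := fun z _ =>
    AddMonoidHom.card_fiber_eq_of_mem_range φ.toAddMonoidHom (hφ z) (hφ y)
  rw [Finset.sum_congr rfl h2] at h
  simp only [Finset.sum_const, smul_eq_mul, Finset.card_univ] at h
  rw [h, mul_comm]

open scoped Classical in
/-- Random coding (Gilbert–Varshamov bound): at least half of the linear maps `g` map no
nonzero vector to a vector of weight at most `w`, and are such that no nonzero functional of weight
at most `w` vanishes on `g (0, ·)`. The latter means that the restrictions of `g (0, ·)` to any `w`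
coordinates are onto. -/
theorem exists_linear_code (F : Type*) [Field F] [Fintype F] (n w r k : ℕ)
    (h1 : 4 * (2 ^ n * Fintype.card F ^ w) * Fintype.card F ^ (r + k) ≤ Fintype.card F ^ n)
    (h2 : 4 * (2 ^ n * Fintype.card F ^ w) ≤ Fintype.card F ^ k) :
    ∃ g : ((Fin r → F) × (Fin k → F)) →ₗ[F] (Fin n → F),
      (∀ u, (Finset.univ.filter fun i => g u i ≠ 0).card ≤ w → u = 0) ∧
      ∀ A : Finset (Fin n), A.card ≤ w → ∀ y : Fin n → F, ∃ t, ∀ i ∈ A, g (0, t) i = y i := by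
  let U := (Fin r → F) × (Fin k → F)
  let H := U →ₗ[F] (Fin n → F)
  have : Finite H := Module.finite_of_finite F
  let : Fintype H := Fintype.ofFinite H
  let : Fintype ((Fin k → F) →ₗ[F] F) :=
    @Fintype.ofFinite _ (Module.finite_of_finite F)
  let Wt := {v : Fin n → F // (Finset.univ.filter fun i => v i ≠ 0).card ≤ w}
  let q := Fintype.card F
  have hq : 0 < q := Fintype.card_pos
  have hWt : Fintype.card Wt ≤ 2 ^ n * q ^ w := card_lowWeight_le F n w
  -- A map is bad if it sends some nonzero `u` to a vector of low weight, or if the functional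
  -- given by some nonzero `z` of low weight vanishes on `g (0, ·)`. Either kind makes up at most a
  -- quarter of all maps.
  let bad1 : U × Wt → Finset H := fun p =>
    if p.1 = 0 then ∅ else Finset.univ.filter fun g => g p.1 = p.2.1
  let pair : (Fin n → F) → H →ₗ[F] ((Fin k → F) →ₗ[F] F) := fun z =>
    { toFun := fun g => (Fintype.linearCombination F z) ∘ₗ g ∘ₗ LinearMap.inr F _ _
      map_add' := fun g g' => by
        rw [LinearMap.add_comp, LinearMap.comp_add]
      map_smul' := fun c g => by
        rw [LinearMap.smul_comp, LinearMap.comp_smul]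
        rfl }
  let bad2 : Wt → Finset H := fun z =>
    if z.1 = 0 then ∅ else Finset.univ.filter fun g => pair z.1 g = 0
  have hbad1 : ∀ p, (bad1 p).card * q ^ n ≤ Fintype.card H := by
    intro p
    by_cases hp : p.1 = 0
    · simp [bad1, hp]
    · have := card_fiber_mul_card (F := F) (LinearMap.applyₗ p.1 : H →ₗ[F] (Fin n → F))
        (fun y => by
          obtain ⟨f, hf⟩ := Module.Projective.exists_dual_ne_zero F hp
          exact ⟨(f p.1)⁻¹ • f.smulRight y, by simp [smul_smul, hf]⟩) p.2.1
      simp only [bad1, hp, if_false]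
      rw [show Fintype.card (Fin n → F) = q ^ n by simp [q]] at this
      simp only [LinearMap.applyₗ_apply_apply] at this
      refine le_of_eq (Eq.trans ?_ this)
      congr!
  have hbad2 : ∀ z, (bad2 z).card * q ^ k ≤ Fintype.card H := by
    intro z
    by_cases hz : z.1 = 0
    · simp [bad2, hz]
    · have := card_fiber_mul_card (F := F) (pair z.1) (fun φ => by
          obtain ⟨i, hi⟩ := Function.ne_iff.1 hz
          refine ⟨(φ ∘ₗ LinearMap.snd F _ _).smulRight (Pi.single i (z.1 i)⁻¹), ?_⟩
          refine LinearMap.ext fun t => ?_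
          simp only [Pi.zero_apply] at hi
          simp [pair, Fintype.linearCombination_apply, Pi.single_apply, hi]
          rfl) 0
      simp only [bad2, hz, if_false]
      have e : Fintype.card ((Fin k → F) →ₗ[F] F) = Fintype.card (Fin k → F) :=
        Fintype.card_congr ((Pi.basisFun F (Fin k)).constr F).symm.toEquiv
      rw [e, show Fintype.card (Fin k → F) = q ^ k by simp [q]] at this
      convert this.le
  have hH : 0 < Fintype.card H := Fintype.card_pos
  have hex : ∃ g : H, g ∉ Finset.univ.biUnion bad1 ∧ g ∉ Finset.univ.biUnion bad2 := by
    by_contra! hcon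
    have hcov : (Finset.univ : Finset H) ⊆ Finset.univ.biUnion bad1 ∪ Finset.univ.biUnion bad2 := by
      intro g _
      rw [Finset.mem_union]
      by_cases hg : g ∈ Finset.univ.biUnion bad1
      · exact Or.inl hg
      · exact Or.inr (hcon g hg)
    have hc0 := (Finset.card_le_card hcov).trans (Finset.card_union_le _ _)
    rw [Finset.card_univ] at hc0
    have hc1 : 4 * (Finset.univ.biUnion bad1).card ≤ Fintype.card H := by
      refine Nat.le_of_mul_le_mul_right ?_ (pow_pos hq n)
      calc 4 * (Finset.univ.biUnion bad1).card * q ^ n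
          ≤ 4 * (∑ p, (bad1 p).card) * q ^ n := by
            gcongr
            exact Finset.card_biUnion_le
        _ = 4 * ∑ p, (bad1 p).card * q ^ n := by rw [mul_assoc, Finset.sum_mul]
        _ ≤ 4 * ∑ _p : U × Wt, Fintype.card H := by
            gcongr with p
            exact hbad1 p
        _ = 4 * (Fintype.card Wt * q ^ (r + k)) * Fintype.card H := by
            simp [U, q, pow_add]
            ring
        _ ≤ 4 * (2 ^ n * q ^ w * q ^ (r + k)) * Fintype.card H := by gcongr
        _ = 4 * (2 ^ n * q ^ w) * q ^ (r + k) * Fintype.card H := by ring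
        _ ≤ q ^ n * Fintype.card H := by gcongr
        _ = Fintype.card H * q ^ n := mul_comm _ _
    have hc2 : 4 * (Finset.univ.biUnion bad2).card ≤ Fintype.card H := by
      refine Nat.le_of_mul_le_mul_right ?_ (pow_pos hq k)
      calc 4 * (Finset.univ.biUnion bad2).card * q ^ k
          ≤ 4 * (∑ p, (bad2 p).card) * q ^ k := by
            gcongr
            exact Finset.card_biUnion_le
        _ = 4 * ∑ p, (bad2 p).card * q ^ k := by rw [mul_assoc, Finset.sum_mul]
        _ ≤ 4 * ∑ _p : Wt, Fintype.card H := by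
            gcongr with p
            exact hbad2 p
        _ = 4 * Fintype.card Wt * Fintype.card H := by
            simp
            ring
        _ ≤ 4 * (2 ^ n * q ^ w) * Fintype.card H := by gcongr
        _ ≤ q ^ k * Fintype.card H := by gcongr
        _ = Fintype.card H * q ^ k := mul_comm _ _
    omega
  obtain ⟨g, hg1, hg2⟩ := hex
  refine ⟨g, fun u hu => ?_, fun A hA y => ?_⟩
  · by_contra hu0
    refine hg1 (Finset.mem_biUnion.2 ⟨(u, ⟨g u, hu⟩), Finset.mem_univ _, ?_⟩)
    simp [bad1, hu0]
  · let h : (Fin k → F) →ₗ[F] (A → F) :=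
      LinearMap.funLeft F F (Subtype.val : A → Fin n) ∘ₗ g ∘ₗ LinearMap.inr F _ _
    suffices hs : LinearMap.range h = ⊤ by
      obtain ⟨t, ht⟩ := LinearMap.range_eq_top.1 hs fun i => y i
      exact ⟨t, fun i hi => congrFun ht ⟨i, hi⟩⟩
    by_contra hne
    obtain ⟨φ, hφ0, hφ⟩ := Submodule.exists_le_ker_of_lt_top _ (lt_top_iff_ne_top.2 hne)
    -- A functional vanishing on the restrictions extends by zero to a `z` of low weight.
    let z : Fin n → F := fun i => if hi : i ∈ A then φ (Pi.single ⟨i, hi⟩ 1) else 0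
    have hzφ : ∀ v : Fin n → F, Fintype.linearCombination F z v = φ fun i : A => v i := by
      intro v
      rw [Fintype.linearCombination_apply]
      conv_rhs => rw [pi_eq_sum_univ (fun i : A => v i), map_sum]
      rw [← Finset.sum_subset (Finset.subset_univ A) (fun i _ hi => by simp [z, hi]),
        ← Finset.sum_coe_sort A]
      refine Finset.sum_congr rfl fun i _ => ?_
      rw [map_smul]
      simp only [z, i.2, dif_pos]
      congr 3
      funext j
      simp [Pi.single_apply, eq_comm]
    have hzw : (Finset.univ.filter fun i => z i ≠ 0).card ≤ w := by
      refine (Finset.card_le_card ?_).trans hA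
      intro i hi
      by_contra hiA
      simp [z, hiA] at hi
    have hz0 : z ≠ 0 := by
      intro hz
      refine hφ0 (LinearMap.ext fun v => ?_)
      have := hzφ fun i => if hi : i ∈ A then v ⟨i, hi⟩ else 0
      rw [hz] at this
      simpa [Fintype.linearCombination_apply] using this.symm
    refine hg2 (Finset.mem_biUnion.2 ⟨⟨z, hzw⟩, Finset.mem_univ _, ?_⟩)
    simp only [bad2, hz0, if_false, Finset.mem_filter, Finset.mem_univ, true_and]
    refine LinearMap.ext fun t => ?_
    have : φ (h t) = 0 := hφ ⟨t, rfl⟩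
    rw [LinearMap.zero_apply, ← this]
    exact hzφ _

end CodeExistence

/-! ### Quantum codes from linear maps -/

section CodeIsometry

variable {F U T I : Type*} [Field F] [Fintype F] [DecidableEq F] [Fintype I] [DecidableEq I]
  [AddCommGroup U] [Module F U] [Fintype U] [DecidableEq U]
  [AddCommGroup T] [Module F T] [Fintype T]

/-- The operator `|s⟩ ↦ |T|^{-1/2} ∑ₜ |g (s, t)⟩`, an isometry if `g` is injective. -/
noncomputable def codeIsometry (g : (U × T) →ₗ[F] (I → F)) : Matrix (I → F) U ℂ :=
  Matrix.of fun y s => ∑ t, if y = g (s, t) then (((Real.sqrt (Fintype.card T))⁻¹ : ℝ) : ℂ) else 0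

theorem codeIsometry_conj_apply (g : (U × T) →ₗ[F] (I → F)) (G : Matrix (I → F) (I → F) ℂ)
    (s s' : U) : ((codeIsometry g)ᴴ * G * codeIsometry g) s s' =
      (Fintype.card T : ℂ)⁻¹ * ∑ t, ∑ t', G (g (s, t)) (g (s', t')) := by
  have hc : (((Real.sqrt (Fintype.card T))⁻¹ : ℝ) : ℂ) * (((Real.sqrt (Fintype.card T))⁻¹ : ℝ) : ℂ)
      = (Fintype.card T : ℂ)⁻¹ := by
    rw [← Complex.ofReal_mul, ← mul_inv, Real.mul_self_sqrt (Nat.cast_nonneg _)]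
    simp
  have hstar : ∀ r : ℝ, star (r : ℂ) = r := Complex.conj_ofReal
  rw [← hc]
  set c : ℂ := (((Real.sqrt (Fintype.card T))⁻¹ : ℝ) : ℂ) with hcdef
  have hsc : star c = c := hstar _
  have h1 : ∀ z, ((codeIsometry g)ᴴ * G) s z = ∑ t, c * G (g (s, t)) z := by
    intro z
    rw [Matrix.mul_apply]
    simp only [codeIsometry, conjTranspose_apply, Matrix.of_apply, star_sum, apply_ite star,
      star_zero, Finset.sum_mul, ite_mul, zero_mul, ← hcdef, hsc]
    rw [Finset.sum_comm]
    simp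
  rw [Matrix.mul_apply]
  simp only [h1]
  simp only [codeIsometry, Matrix.of_apply, ← hcdef, Finset.mul_sum, mul_ite, mul_zero]
  rw [Finset.sum_comm]
  simp only [Finset.sum_ite_eq', Finset.mem_univ, if_true, Finset.sum_mul]
  rw [Finset.sum_comm]
  refine Finset.sum_congr rfl fun t _ => Finset.sum_congr rfl fun t' _ => ?_
  ring

/-- If `h` maps onto the coordinates in `A`, then averaging a function of these coordinates over
a translate of the range of `h` is averaging it over the whole space. -/
theorem average_comp_linearMap (h : T →ₗ[F] (I → F)) (A : Finset I)
    (hA : ∀ y : I → F, ∃ t, ∀ i ∈ A, h t i = y i) (ψ : (I → F) → ℂ)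
    (hψ : ∀ y y', (∀ i ∈ A, y i = y' i) → ψ y = ψ y') (y₀ : I → F) :
    (Fintype.card T : ℂ)⁻¹ * ∑ t, ψ (y₀ + h t) =
      (Fintype.card (I → F) : ℂ)⁻¹ * ∑ y, ψ y := by
  have h1 : ∑ y : I → F, ∑ t, ψ (y + (y₀ + h t)) = Fintype.card T * ∑ y, ψ y := by
    rw [Finset.sum_comm]
    have : ∀ t, ∑ y, ψ (y + (y₀ + h t)) = ∑ y, ψ y := fun t =>
      Fintype.sum_equiv (Equiv.addRight (y₀ + h t)) _ _ fun _ => rfl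
    simp [this]
  have h2 : ∑ y : I → F, ∑ t, ψ (y + (y₀ + h t)) =
      Fintype.card (I → F) * ∑ t, ψ (y₀ + h t) := by
    -- On the coordinates in `A` the shift by `y` is a shift of `t`.
    have : ∀ y, ∑ t, ψ (y + (y₀ + h t)) = ∑ t, ψ (y₀ + h t) := by
      intro y
      obtain ⟨t₁, ht₁⟩ := hA y
      refine Fintype.sum_equiv (Equiv.addRight t₁) _ _ fun t => hψ _ _ fun i hi => ?_
      simp only [Pi.add_apply, Equiv.coe_addRight, map_add, ht₁ i hi]
      ring
    simp [this]
  have hT : (Fintype.card T : ℂ) ≠ 0 := Nat.cast_ne_zero.2 Fintype.card_ne_zero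
  have hY : (Fintype.card (I → F) : ℂ) ≠ 0 := Nat.cast_ne_zero.2 Fintype.card_ne_zero
  have h3 := h1.symm.trans h2
  field_simp
  rw [mul_comm, ← h3]

open scoped Classical in
/-- The Knill–Laflamme condition: if distinct code words `g u` differ in more than `w` places and
`g (0, ·)` is onto any `w` coordinates, an operator acting on at most `w` tensor factors does not
connect distinct code words, and has the same expectation as in the maximally mixed state. -/
theorem codeIsometry_knillLaflamme (g : (U × T) →ₗ[F] (I → F)) (w : ℕ)
    (hg : ∀ u, (Finset.univ.filter fun i => g u i ≠ 0).card ≤ w → u = 0)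
    (hg' : ∀ A : Finset I, A.card ≤ w → ∀ y : I → F, ∃ t, ∀ i ∈ A, g (0, t) i = y i)
    {G : Matrix (I → F) (I → F) ℂ} (hG : G ∈ localOperators F I w) :
    (codeIsometry g)ᴴ * G * codeIsometry g = normalizedTrace (I → F) G • 1 := by
  induction hG using Submodule.span_induction with
  | zero => simp
  | add _ _ _ _ h1 h2 =>
    rw [Matrix.mul_add, Matrix.add_mul, h1, h2, map_add, add_smul]
  | smul c _ _ h => rw [Matrix.mul_smul, Matrix.smul_mul, h, map_smul, smul_eq_mul, mul_smul]
  | mem G hG =>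
    obtain ⟨B, hB, rfl⟩ := hG
    -- Distinct code words differ in more than `w` places, so in one where `B i = 1`.
    have hoff : ∀ u u', u ≠ u' → pureTensor B (g u) (g u') = 0 := by
      intro u u' huu
      have h1 : ¬ (Finset.univ.filter fun i => g (u - u') i ≠ 0) ⊆
          Finset.univ.filter fun i => B i ≠ 1 := fun h =>
        huu (sub_eq_zero.1 (hg _ ((Finset.card_le_card h).trans hB)))
      obtain ⟨i, hi, hi'⟩ := Finset.not_subset.1 h1
      simp only [Finset.mem_filter, Finset.mem_univ, true_and, not_not] at hi hi'
      refine Finset.prod_eq_zero (Finset.mem_univ i) ?_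
      rw [hi', Matrix.one_apply_ne]
      intro h2
      apply hi
      rw [map_sub, Pi.sub_apply, h2, sub_self]
    ext s s'
    rw [codeIsometry_conj_apply]
    by_cases hs : s = s'
    · subst hs
      have h2 : ∀ t, ∑ t', pureTensor B (g (s, t)) (g (s, t')) =
          pureTensor B (g (s, 0) + (g ∘ₗ LinearMap.inr F U T) t)
            (g (s, 0) + (g ∘ₗ LinearMap.inr F U T) t) := by
        intro t
        rw [Finset.sum_eq_single t]
        · rw [LinearMap.comp_apply, ← map_add]
          simp
        · intro t' _ ht'
          exact hoff _ _ fun h => ht' (Prod.ext_iff.1 h).2.symm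
        · simp
      simp only [h2]
      rw [average_comp_linearMap (g ∘ₗ LinearMap.inr F U T)
        (Finset.univ.filter fun i => B i ≠ 1) (hg' _ hB) (fun y => pureTensor B y y)]
      · simp [normalizedTrace_apply, Matrix.trace]
      · intro y y' hyy
        refine Finset.prod_congr rfl fun i _ => ?_
        by_cases hi : B i = 1
        · simp [hi]
        · rw [hyy i (by simpa using hi)]
    · rw [Matrix.smul_apply, Matrix.one_apply_ne hs, smul_zero]
      rw [Finset.sum_eq_zero fun t _ => Finset.sum_eq_zero fun t' _ =>
        hoff _ _ fun h => hs (Prod.ext_iff.1 h).1, mul_zero]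

/-- A code that corrects `f` errors turns a channel `R` with `‖R - id‖_cb ≤ ε` into one that is
close to the identity: in the binomial expansion of `(id + (R - id))^{⊗n}` the terms with at most
`f` factors `R - id` are corrected, so they are multiples of the identity that vanish because
`R - id` kills `1`. -/
theorem exists_coding_of_code {n : ℕ} (g : (U × T) →ₗ[F] (Fin n → F)) (f : ℕ)
    (hg : ∀ u, (Finset.univ.filter fun i => g u i ≠ 0).card ≤ f + f → u = 0)
    (hg' : ∀ A : Finset (Fin n), A.card ≤ f + f → ∀ y : Fin n → F, ∃ t, ∀ i ∈ A, g (0, t) i = y i)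
    {R : Matrix F F ℂ →ₗ[ℂ] Matrix F F ℂ} (hR : IsChannel R) {ε : ℝ≥0∞} (hε1 : ε ≤ 1)
    (hε : cbNorm (R - LinearMap.id) ≤ ε) :
    ∃ E : Matrix (Fin n → F) (Fin n → F) ℂ →ₗ[ℂ] Matrix U U ℂ, IsChannel E ∧
      ∃ D : Matrix U U ℂ →ₗ[ℂ] Matrix (Fin n → F) (Fin n → F) ℂ, IsChannel D ∧
        cbNorm (E ∘ₗ tensorPower R n ∘ₗ D - LinearMap.id) ≤ 2 ^ n * ε ^ (f + 1) := by
  have hKL : ∀ G ∈ localOperators F (Fin n) (f + f),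
      (codeIsometry g)ᴴ * G * codeIsometry g = normalizedTrace (Fin n → F) G • 1 := by
    intro G hG
    refine codeIsometry_knillLaflamme g (f + f) (fun u hu => hg u (le_of_eq_of_le ?_ hu)) hg' hG
    congr!
  obtain ⟨D, hD, hDV⟩ := exists_decoder (codeIsometry g) (localOperators F (Fin n) f)
    fun G hG H hH => hKL _ (mul_mem_localOperators (conjTranspose_mem_localOperators hG) hH)
  have hV1 : (codeIsometry g)ᴴ * codeIsometry g = 1 := by
    have := hKL 1 (one_mem_localOperators _)
    rwa [normalizedTrace_one, one_smul, Matrix.mul_one] at this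
  refine ⟨compression (codeIsometry g), isChannel_compression hV1, D, hD, ?_⟩
  have hscalar : ∀ Φ ∈ localMaps F (Fin n) f, ∃ c : ℂ, ∀ X,
      compression (codeIsometry g) (Φ (D X)) = c • X := by
    intro Φ hΦ
    induction hΦ using Submodule.span_induction with
    | zero => exact ⟨0, fun X => by simp⟩
    | add _ _ _ _ h1 h2 =>
      obtain ⟨c, hc⟩ := h1
      obtain ⟨d, hd⟩ := h2
      exact ⟨c + d, fun X => by rw [LinearMap.add_apply, map_add, hc, hd, add_smul]⟩
    | smul a _ _ h =>
      obtain ⟨c, hc⟩ := h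
      exact ⟨a * c, fun X => by rw [LinearMap.smul_apply, map_smul, hc, smul_smul]⟩
    | mem Φ hΦ =>
      obtain ⟨G, hG, H, hH, h⟩ := hΦ
      exact ⟨_, fun X => by rw [h, compression_apply, hDV X G hG H hH]⟩
  let S := R - LinearMap.id
  have hS1 : S 1 = 0 := by simp [S, hR.2]
  let term : Finset (Fin n) → Matrix U U ℂ →ₗ[ℂ] Matrix U U ℂ := fun s =>
    compression (codeIsometry g) ∘ₗ
      tensorMap (fun j => if j ∈ s then S else LinearMap.id) ∘ₗ D
  have hexp : compression (codeIsometry g) ∘ₗ tensorPower R n ∘ₗ D = ∑ s, term s := by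
    have : tensorPower R n =
        ∑ s : Finset (Fin n), tensorMap fun j => if j ∈ s then S else LinearMap.id := by
      rw [← tensorMap_add, tensorPower_eq_tensorMap]
      simp [S]
    rw [this]
    ext1 X
    simp [term, LinearMap.sum_apply]
  have hempty : term ∅ = LinearMap.id := by
    refine LinearMap.ext fun X => ?_
    simp only [term, tensorMap_ite_empty, LinearMap.id_comp, LinearMap.comp_apply,
      compression_apply, LinearMap.id_apply]
    have := hDV X 1 (one_mem_localOperators _) 1 (one_mem_localOperators _)
    simpa [normalizedTrace_one] using this
  have hsmall : ∀ s : Finset (Fin n), s ≠ ∅ → s.card ≤ f → term s = 0 := by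
    intro s hs hsf
    obtain ⟨c, hc⟩ := hscalar _ (localMaps_mono hsf (tensorMap_ite_mem_localMaps S s))
    have h1 : tensorMap (fun j => if j ∈ s then S else LinearMap.id)
        (1 : Matrix (Fin n → F) (Fin n → F) ℂ) = 0 := by
      obtain ⟨i, hi⟩ := Finset.nonempty_iff_ne_empty.2 hs
      rw [← pureTensor_one, tensorMap_pureTensor]
      ext x y
      refine Finset.prod_eq_zero (Finset.mem_univ i) ?_
      simp [hi, hS1]
    have h2 := hc 1
    rw [hD.2, h1, map_zero] at h2
    have hc0 : c = 0 := by
      have := congrFun₂ h2 0 0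
      simpa using this.symm
    refine LinearMap.ext fun X => ?_
    rw [LinearMap.zero_apply, ← zero_smul ℂ X, ← hc0]
    exact hc X
  have hsum : compression (codeIsometry g) ∘ₗ tensorPower R n ∘ₗ D - LinearMap.id =
      ∑ s ∈ Finset.univ.filter fun s : Finset (Fin n) => f < s.card, term s := by
    rw [hexp, ← Finset.add_sum_erase _ _ (Finset.mem_univ ∅), hempty, add_sub_cancel_left]
    symm
    refine Finset.sum_subset (fun s hs => ?_) fun s hs hs' => ?_
    · refine Finset.mem_erase.2 ⟨?_, Finset.mem_univ _⟩
      rintro rfl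
      simp at hs
    · exact hsmall s (Finset.ne_of_mem_erase hs) (by simpa using hs')
  rw [hsum]
  calc _ ≤ ∑ s ∈ Finset.univ.filter fun s : Finset (Fin n) => f < s.card, cbNorm (term s) :=
        cbNorm_sum_le _
    _ ≤ ∑ s ∈ Finset.univ.filter fun s : Finset (Fin n) => f < s.card, ε ^ (f + 1) := by
        refine Finset.sum_le_sum fun s hs => ?_
        refine (cbNorm_comp_comp_le (isChannel_compression hV1) hD _).trans
          ((cbNorm_tensorMap_ite_le S s).trans ?_)
        refine (pow_le_pow_left' hε _).trans (pow_le_pow_right_of_le_one' hε1 ?_)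
        simpa using hs
    _ ≤ 2 ^ n * ε ^ (f + 1) := by
        rw [Finset.sum_const, nsmul_eq_mul]
        gcongr
        refine (Nat.cast_le.2 (Finset.card_le_univ _)).trans ?_
        simp

end CodeIsometry

/-! ### Coding for smaller systems -/

section Embedding

variable {ι κ S Y : Type*} [Fintype ι] [DecidableEq ι] [Fintype κ] [DecidableEq κ]
  [Fintype S] [DecidableEq S] [Fintype Y] [DecidableEq Y]

/-- The operator `|s⟩ ↦ |j s⟩`. -/
def basisMap (j : S → Y) : Matrix Y S ℂ := Matrix.of fun y s => if y = j s then 1 else 0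

theorem compression_basisMap_apply (j : S → Y) (G : Matrix Y Y ℂ) (s s' : S) :
    compression (basisMap j) G s s' = G (j s) (j s') := by
  simp [compression_apply, basisMap, Matrix.mul_apply, apply_ite]

theorem basisMap_conjTranspose_mul_self {j : S → Y} (hj : Function.Injective j) :
    (basisMap j)ᴴ * basisMap j = 1 := by
  have : compression (basisMap j) 1 = 1 := by
    ext s s'
    rw [compression_basisMap_apply, Matrix.one_apply, Matrix.one_apply]
    simp [hj.eq_iff]
  simpa [compression_apply] using this

/-- A smaller system is encoded without error in a larger one. -/
theorem exists_channels_of_injective [Nonempty S] {j : S → Y} (hj : Function.Injective j) :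
    ∃ E : Matrix Y Y ℂ →ₗ[ℂ] Matrix S S ℂ, IsChannel E ∧
      ∃ D : Matrix S S ℂ →ₗ[ℂ] Matrix Y Y ℂ, IsChannel D ∧ E ∘ₗ D = LinearMap.id := by
  have : Nonempty Y := Nonempty.map j inferInstance
  have hV := basisMap_conjTranspose_mul_self hj
  obtain ⟨D, hD, hDV⟩ := exists_decoder (basisMap j) (Submodule.span ℂ {1}) fun F hF G hG => by
    obtain ⟨a, rfl⟩ := Submodule.mem_span_singleton.1 hF
    obtain ⟨b, rfl⟩ := Submodule.mem_span_singleton.1 hG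
    simp [hV, normalizedTrace_one, smul_smul]
  refine ⟨compression (basisMap j), isChannel_compression hV, D, hD, LinearMap.ext fun X => ?_⟩
  have := hDV X 1 (Submodule.mem_span_singleton_self _) 1 (Submodule.mem_span_singleton_self _)
  simpa [normalizedTrace_one, compression_apply] using this

/-- A coding for dimension `M` with error below `ε` restricts to systems of dimension at
most `M`. -/
theorem exists_coding_of_codingError_lt [Nonempty S] {T : Matrix ι ι ℂ →ₗ[ℂ] Matrix κ κ ℂ} {M : ℕ}
    {ε : ℝ≥0∞} (h : codingError T M < ε) (hS : Fintype.card S ≤ M) :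
    ∃ E : Matrix κ κ ℂ →ₗ[ℂ] Matrix S S ℂ, IsChannel E ∧
      ∃ D : Matrix S S ℂ →ₗ[ℂ] Matrix ι ι ℂ, IsChannel D ∧
        cbNorm (E ∘ₗ T ∘ₗ D - LinearMap.id) < ε := by
  simp only [codingError, iInf_lt_iff] at h
  obtain ⟨E, hE, D, hD, h⟩ := h
  obtain ⟨j⟩ : Nonempty (S ↪ Fin M) := Function.Embedding.nonempty_of_card_le (by simpa using hS)
  obtain ⟨E', hE', D', hD', hid⟩ := exists_channels_of_injective j.injective
  refine ⟨E' ∘ₗ E, hE'.comp hE, D ∘ₗ D', hD.comp hD', lt_of_le_of_lt ?_ h⟩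
  refine (le_of_eq ?_).trans (cbNorm_comp_comp_le hE' hD' _)
  rw [LinearMap.sub_comp, LinearMap.comp_sub, LinearMap.id_comp, hid]
  rfl

/-- A coding for a system of dimension at least `M` bounds the optimal coding error. -/
theorem codingError_le_of_coding {T : Matrix ι ι ℂ →ₗ[ℂ] Matrix κ κ ℂ} {M : ℕ} (hM : 0 < M)
    (hS : M ≤ Fintype.card S) {E : Matrix κ κ ℂ →ₗ[ℂ] Matrix S S ℂ} (hE : IsChannel E)
    {D : Matrix S S ℂ →ₗ[ℂ] Matrix ι ι ℂ} (hD : IsChannel D) :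
    codingError T M ≤ cbNorm (E ∘ₗ T ∘ₗ D - LinearMap.id) := by
  have : Nonempty (Fin M) := ⟨⟨0, hM⟩⟩
  obtain ⟨j⟩ : Nonempty (Fin M ↪ S) := Function.Embedding.nonempty_of_card_le (by simpa using hS)
  obtain ⟨E', hE', D', hD', hid⟩ := exists_channels_of_injective j.injective
  refine (iInf_le_of_le (E' ∘ₗ E) (iInf_le_of_le (hE'.comp hE) (iInf_le_of_le (D ∘ₗ D')
    (iInf_le_of_le (hD.comp hD') le_rfl)))).trans ?_
  refine (le_of_eq ?_).trans (cbNorm_comp_comp_le hE' hD' _)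
  rw [LinearMap.sub_comp, LinearMap.comp_sub, LinearMap.id_comp, hid]
  rfl

end Embedding

/-! ### Division into blocks -/

section Blocks

variable {ι κ ι' : Type*} [Fintype ι] [DecidableEq ι] [Fintype κ] [DecidableEq κ]
  [Fintype ι'] [DecidableEq ι']

theorem tensorPower_comp (S : Matrix κ κ ℂ →ₗ[ℂ] Matrix ι' ι' ℂ)
    (T : Matrix ι ι ℂ →ₗ[ℂ] Matrix κ κ ℂ) (n : ℕ) :
    tensorPower (S ∘ₗ T) n = tensorPower S n ∘ₗ tensorPower T n :=
  linearMap_ext_pureTensor fun A => by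
    simp only [tensorPower_eq_tensorMap, LinearMap.comp_apply, tensorMap_pureTensor]

/-- Operators on `k` blocks of `m` systems are determined by their values on products over all
`k m` systems. -/
theorem linearMap_ext_pureTensor_pureTensor {k m : ℕ} {M : Type*} [AddCommGroup M] [Module ℂ M]
    {f g : Matrix (Fin k → Fin m → ι) (Fin k → Fin m → ι) ℂ →ₗ[ℂ] M}
    (h : ∀ A : Fin k → Fin m → Matrix ι ι ℂ,
      f (pureTensor fun a => pureTensor (A a)) = g (pureTensor fun a => pureTensor (A a))) :
    f = g := by
  refine linearMap_ext_single fun u v => ?_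
  simp only [single_eq_pureTensor u v, single_eq_pureTensor (u _) (v _)]
  exact h _

/-- Among `n ≥ m k` uses of `T` one finds `k` blocks of `m` uses: the remaining inputs are set to
a fixed state and the remaining outputs are ignored. -/
theorem exists_block_channels [Nonempty κ] {T : Matrix ι ι ℂ →ₗ[ℂ] Matrix κ κ ℂ}
    (hT : IsChannel T) {m k n : ℕ} (h : m * k ≤ n) :
    ∃ E : Matrix (Fin n → κ) (Fin n → κ) ℂ →ₗ[ℂ]
        Matrix (Fin k → Fin m → κ) (Fin k → Fin m → κ) ℂ, IsChannel E ∧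
      ∃ D : Matrix (Fin k → Fin m → ι) (Fin k → Fin m → ι) ℂ →ₗ[ℂ]
        Matrix (Fin n → ι) (Fin n → ι) ℂ, IsChannel D ∧
        E ∘ₗ tensorPower T n ∘ₗ D = tensorPower (tensorPower T m) k := by
  let σ : (Fin k × Fin m) ⊕ Fin (n - m * k) ≃ Fin n := Fintype.equivOfCardEq (by
    simp only [Fintype.card_sum, Fintype.card_prod, Fintype.card_fin]
    rw [mul_comm k m]
    omega)
  have hσ : ∀ φ : Fin n → ℂ, ∏ i, φ i =
      (∏ a, ∏ b, φ (σ (Sum.inl (a, b)))) * ∏ c, φ (σ (Sum.inr c)) := by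
    intro φ
    rw [← Fintype.prod_equiv σ (fun x => φ (σ x)) φ fun _ => rfl, Fintype.prod_sum_type,
      Fintype.prod_prod_type]
  -- The Kraus operators of `X ↦ X ⊗ 1`, one for each basis state of the unused systems.
  let K : (Fin (n - m * k) → ι) → Matrix (Fin k → Fin m → ι) (Fin n → ι) ℂ := fun l =>
    Matrix.of fun w u => if w = fun a b => u (σ (Sum.inl (a, b))) then
      if l = fun c => u (σ (Sum.inr c)) then 1 else 0 else 0
  let D : Matrix (Fin k → Fin m → ι) (Fin k → Fin m → ι) ℂ →ₗ[ℂ]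
      Matrix (Fin n → ι) (Fin n → ι) ℂ := ∑ l, compression (K l)
  have hD : ∀ X, D X = ∑ l, (K l)ᴴ * X * K l := fun X => by
    simp only [D, LinearMap.sum_apply, compression_apply]
  have hDpure : ∀ A : Fin k → Fin m → Matrix ι ι ℂ,
      D (pureTensor fun a => pureTensor (A a)) =
        pureTensor fun i => Sum.elim (fun p => A p.1 p.2) (fun _ => 1) (σ.symm i) := by
    intro A
    ext u v
    have h1 : ∏ c, (1 : Matrix ι ι ℂ) (u (σ (Sum.inr c))) (v (σ (Sum.inr c))) =
        if (fun c => u (σ (Sum.inr c))) = fun c => v (σ (Sum.inr c)) then 1 else 0 := by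
      rw [← Matrix.one_apply, ← pureTensor_one]
      rfl
    rw [pureTensor_apply, hσ]
    simp only [Equiv.symm_apply_apply, Sum.elim_inl, Sum.elim_inr, h1]
    have h2 : ∀ (X : Matrix (Fin k → Fin m → ι) (Fin k → Fin m → ι) ℂ) (l : Fin (n - m * k) → ι),
        ((K l)ᴴ * X * K l) u v = if l = fun c => u (σ (Sum.inr c)) then
          if l = fun c => v (σ (Sum.inr c)) then
            X (fun a b => u (σ (Sum.inl (a, b)))) (fun a b => v (σ (Sum.inl (a, b))))
          else 0 else 0 := by
      intro X l
      simp only [Matrix.mul_apply, K, Matrix.of_apply, conjTranspose_apply, apply_ite star,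
        star_one, star_zero, ite_mul, one_mul, zero_mul, mul_ite, mul_one, mul_zero,
        Finset.sum_ite_eq', Finset.mem_univ, if_true]
      split_ifs <;> simp
    rw [hD, Matrix.sum_apply]
    simp only [h2, Finset.sum_ite_eq', Finset.mem_univ, if_true, pureTensor_apply, mul_ite,
      mul_one, mul_zero]
  have hDone : D 1 = 1 := by
    have h1 : (1 : Matrix (Fin k → Fin m → ι) (Fin k → Fin m → ι) ℂ) =
        pureTensor fun _ => pureTensor fun _ => 1 := by rw [pureTensor_one, pureTensor_one]
    rw [h1, hDpure, ← pureTensor_one]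
    congr 1
    funext i
    rcases σ.symm i with p | c <;> rfl
  let x₀ : κ := Classical.arbitrary κ
  let j : (Fin k → Fin m → κ) → Fin n → κ := fun w i =>
    Sum.elim (fun p => w p.1 p.2) (fun _ => x₀) (σ.symm i)
  have hj : Function.Injective j := by
    intro w w' hw
    funext a b
    simpa [j] using congrFun hw (σ (Sum.inl (a, b)))
  refine ⟨compression (basisMap j), isChannel_compression (basisMap_conjTranspose_mul_self hj), D,
    ⟨isCompletelyPositive_of_kraus K hD, hDone⟩, ?_⟩
  refine linearMap_ext_pureTensor_pureTensor fun A => ?_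
  simp only [LinearMap.comp_apply, hDpure, tensorPower_eq_tensorMap, tensorMap_pureTensor]
  ext w w'
  rw [compression_basisMap_apply, pureTensor_apply, hσ]
  simp [j, hT.2, pureTensor_apply]

end Blocks

/-! ### Rates -/

section Rates

/-- The bookkeeping of rates: `K = ⌊n / m⌋` blocks carry `a = ⌊c' m⌋` qubits each, a code that
corrects `⌊K / L⌋` block errors costs `4 ⌊K / L⌋ + 2 (⌊(K + 2) / a⌋ + 1)` blocks, and at least
`⌊c n⌋` qubits are left. -/
theorem rate_bound {c c' : ℝ} (hc : 0 ≤ c) (hcc : c < c') {L m a n : ℕ}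
    (hL : 16 * c' ≤ (c' - c) * L) (hm : 12 ≤ (c' - c) * m) (hm1 : 1 ≤ c' * m)
    (ha : a = ⌊c' * m⌋₊) (hn : 6 * c' * m + 8 ≤ (c' - c) * n) :
    4 * (n / m / L) + 2 * ((n / m + 2) / a + 1) ≤ n / m ∧
      ⌊c * n⌋₊ ≤ a * (n / m - (4 * (n / m / L) + 2 * ((n / m + 2) / a + 1))) := by
  have hc' : 0 < c' := lt_of_le_of_lt hc hcc
  have hγ : 0 < c' - c := sub_pos.2 hcc
  have hLpos : (0 : ℝ) < L := by
    by_contra hL0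
    nlinarith
  have hmpos : (0 : ℝ) < m := by
    by_contra hm0
    nlinarith
  have ha1 : 1 ≤ a := by
    rw [ha]
    exact Nat.le_floor (by simpa using hm1)
  have ha_le : (a : ℝ) ≤ c' * m := by
    rw [ha]
    exact Nat.floor_le (by positivity)
  have ha_gt : c' * m - 1 ≤ a := by
    rw [ha]
    linarith [Nat.lt_floor_add_one (c' * (m : ℝ))]
  have haR : (1 : ℝ) ≤ a := by exact_mod_cast ha1
  set K := n / m with hK
  have hK_le : (K : ℝ) * m ≤ n := by exact_mod_cast Nat.div_mul_le_self n m
  have hK_gt : (n : ℝ) ≤ (K + 1) * m := by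
    have h1 : n < (K + 1) * m := by
      have := Nat.lt_div_mul_add (a := n) (b := m) (by exact_mod_cast hmpos)
      rw [hK]
      linarith
    exact_mod_cast h1.le
  have hf : ((K / L : ℕ) : ℝ) * L ≤ K := by exact_mod_cast Nat.div_mul_le_self K L
  set f := K / L with hf'
  have hb : (((K + 2) / a : ℕ) : ℝ) * a ≤ K + 2 := by
    exact_mod_cast Nat.div_mul_le_self (K + 2) a
  set b := (K + 2) / a with hb'
  have hKm : (K : ℝ) ≤ (c' - c) * n / 12 := by
    have : (K : ℝ) * 12 ≤ K * ((c' - c) * m) := by gcongr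
    nlinarith
  have h4 : (a : ℝ) * (4 * f) ≤ (c' - c) * n / 4 := by
    have h5 : (f : ℝ) * (16 * c') ≤ f * ((c' - c) * L) := by gcongr
    have h6 : (f : ℝ) * (16 * c') ≤ (c' - c) * K := by nlinarith
    have h7 : (a : ℝ) * (4 * f) ≤ c' * m * (4 * f) := by gcongr
    have h8 : (f : ℝ) * (16 * c') * m ≤ (c' - c) * K * m := by gcongr
    nlinarith
  have h9 : c' * n - (c' - c) * n / 12 - 2 * (c' * m) ≤ a * K := by
    have h10 : (c' * m - 1) * K ≤ a * K := by gcongr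
    nlinarith
  have h11 : c * n ≤ a * K - a * (4 * f + 2 * (b + 1)) := by nlinarith
  have hcn : 0 ≤ c * n := by positivity
  have h12 : 4 * f + 2 * (b + 1) ≤ K := by
    have : (a : ℝ) * (4 * f + 2 * (b + 1)) ≤ a * K := by linarith
    have := le_of_mul_le_mul_left this (by linarith)
    exact_mod_cast this
  refine ⟨h12, Nat.floor_le_of_le ?_⟩
  rw [Nat.cast_mul, Nat.cast_sub h12]
  push_cast
  linarith

end Rates

/-! ### The error exponent -/

section Exponent

variable {ι κ : Type*} [Fintype ι] [DecidableEq ι] [Fintype κ] [DecidableEq κ]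

/-- Coding over `K = ⌊n / m⌋` blocks: a channel on the field with `2 ^ a` elements obtained from
`m` uses of `T` with error less than `8 ^ (-L)` is concatenated with a code correcting `⌊K / L⌋`
block errors. -/
theorem codingError_le_of_block {T : Matrix ι ι ℂ →ₗ[ℂ] Matrix κ κ ℂ} (hT : IsChannel T)
    [Nonempty κ] {L m a n M : ℕ} (ha : a ≠ 0) (hL : 0 < L) {F : Type*} [Field F] [Fintype F]
    [DecidableEq F] (hF : Fintype.card F = 2 ^ a)
    {E : Matrix (Fin m → κ) (Fin m → κ) ℂ →ₗ[ℂ] Matrix F F ℂ} (hE : IsChannel E)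
    {D : Matrix F F ℂ →ₗ[ℂ] Matrix (Fin m → ι) (Fin m → ι) ℂ} (hD : IsChannel D)
    (hED : cbNorm (E ∘ₗ tensorPower T m ∘ₗ D - LinearMap.id) ≤ ((8 : ℝ≥0∞)⁻¹) ^ L)
    (hr : 4 * (n / m / L) + 2 * ((n / m + 2) / a + 1) ≤ n / m)
    (hM : M ≤ a * (n / m - (4 * (n / m / L) + 2 * ((n / m + 2) / a + 1)))) :
    codingError (tensorPower T n) (2 ^ M) ≤ ((4 : ℝ≥0∞)⁻¹) ^ (n / m) := by
  set K := n / m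
  set f := K / L
  set b := (K + 2) / a + 1 with hb
  have hab : K + 2 ≤ a * b := by
    rw [hb]
    exact (Nat.lt_mul_div_succ (K + 2) (Nat.pos_of_ne_zero ha)).le
  obtain ⟨r, hrK⟩ := Nat.exists_eq_add_of_le hr
  have hrM : M ≤ a * r := by
    refine hM.trans_eq ?_
    congr 1
    omega
  have hK : K = 4 * f + 2 * b + r := hrK
  have hcode := exists_linear_code F K (f + f) r (2 * f + b) (by
      rw [hF, ← pow_mul, ← pow_mul, ← pow_mul, show 4 = 2 ^ 2 by norm_num, ← pow_add, ← pow_add,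
        ← pow_add]
      refine Nat.pow_le_pow_right two_pos ?_
      have : a * K = a * (f + f) + a * (r + (2 * f + b)) + a * b := by
        rw [← mul_add, ← mul_add]
        congr 1
        omega
      omega) (by
      rw [hF, ← pow_mul, ← pow_mul, show 4 = 2 ^ 2 by norm_num, ← pow_add, ← pow_add]
      refine Nat.pow_le_pow_right two_pos ?_
      have : a * (2 * f + b) = a * (f + f) + a * b := by ring
      omega)
  obtain ⟨g, hg, hg'⟩ := hcode
  have h8 : ((8 : ℝ≥0∞)⁻¹) ≤ 1 := ENNReal.inv_le_one.2 (by norm_num)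
  obtain ⟨E₁, hE₁, D₁, hD₁, h₁⟩ := exists_block_channels hT (Nat.mul_div_le n m)
  obtain ⟨E₂, hE₂, D₂, hD₂, h₂⟩ := exists_coding_of_code g f
    (fun u hu => hg u (le_of_eq_of_le (by congr!) hu)) hg'
    (hE.comp ((hT.tensorPower m).comp hD)) (pow_le_one' h8 L) hED
  have hcomp : (E₂ ∘ₗ tensorPower E K ∘ₗ E₁) ∘ₗ tensorPower T n ∘ₗ
      (D₁ ∘ₗ tensorPower D K ∘ₗ D₂) =
      E₂ ∘ₗ tensorPower (E ∘ₗ tensorPower T m ∘ₗ D) K ∘ₗ D₂ := by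
    rw [tensorPower_comp, tensorPower_comp, ← h₁]
    rfl
  refine (codingError_le_of_coding (by positivity) ?_
    (hE₂.comp ((hE.tensorPower K).comp hE₁)) (hD₁.comp ((hD.tensorPower K).comp hD₂))).trans ?_
  · rw [Fintype.card_fun, Fintype.card_fin, hF, ← pow_mul]
    exact Nat.pow_le_pow_right two_pos hrM
  · rw [hcomp]
    refine h₂.trans ?_
    rw [← pow_mul]
    calc (2 : ℝ≥0∞) ^ K * (8 : ℝ≥0∞)⁻¹ ^ (L * (f + 1)) ≤ 2 ^ K * (8 : ℝ≥0∞)⁻¹ ^ K := by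
          gcongr 2 ^ K * ?_
          exact pow_le_pow_right_of_le_one' h8 (Nat.lt_mul_div_succ K hL).le
      _ = (4 : ℝ≥0∞)⁻¹ ^ K := by
          rw [← mul_pow]
          congr 1
          rw [show (8 : ℝ≥0∞) = 2 * 4 by norm_num, ENNReal.mul_inv (by simp) (by simp),
            ← mul_assoc, ENNReal.mul_inv_cancel (by simp) (by simp), one_mul]

/-- There are no unital maps from the zero algebra `𝓑(ℂ^∅)`, so the infimum that defines the coding
error is empty if `κ` is. -/
theorem nonempty_of_codingError_ne_top {T : Matrix ι ι ℂ →ₗ[ℂ] Matrix κ κ ℂ} {M : ℕ} (hM : 0 < M)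
    (h : codingError T M ≠ ⊤) : Nonempty κ := by
  by_contra hκ
  rw [not_nonempty_iff] at hκ
  refine h (iInf_eq_top.2 fun E => iInf_eq_top.2 fun hE => ?_)
  have h1 := congrFun₂ hE.2 ⟨0, hM⟩ ⟨0, hM⟩
  rw [Subsingleton.elim (1 : Matrix κ κ ℂ) 0, map_zero] at h1
  simp at h1

theorem inv_four_pow_div_le_exp {m n : ℕ} (hm : 0 < m) (hn : 2 * m ≤ n) :
    ((4 : ℝ≥0∞)⁻¹) ^ (n / m) ≤ ENNReal.ofReal (Real.exp (-((n : ℝ) * (1 / (2 * m))))) := by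
  have h1 : ((4 : ℝ≥0∞)⁻¹) = ENNReal.ofReal (4⁻¹) := by
    rw [ENNReal.ofReal_inv_of_pos (by norm_num)]
    simp
  rw [h1, ← ENNReal.ofReal_pow (by norm_num)]
  refine ENNReal.ofReal_le_ofReal ?_
  have h2 : (4 : ℝ)⁻¹ ≤ Real.exp (-1) := by
    rw [Real.exp_neg]
    gcongr
    linarith [Real.exp_one_lt_d9]
  have hmR : (0 : ℝ) < m := by exact_mod_cast hm
  have h3 : (n : ℝ) * (1 / (2 * m)) ≤ ((n / m : ℕ) : ℝ) := by
    have h4 : n < n / m * m + m := Nat.lt_div_mul_add hm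
    have h5 : (n : ℝ) ≤ (n / m : ℕ) * m + m := by exact_mod_cast h4.le
    have h6 : (2 : ℝ) * m ≤ n := by exact_mod_cast hn
    rw [mul_one_div, div_le_iff₀ (by positivity)]
    linarith
  calc (4⁻¹ : ℝ) ^ (n / m) ≤ Real.exp (-1) ^ (n / m) := by gcongr
    _ = Real.exp (-((n / m : ℕ) : ℝ)) := by
        rw [← Real.exp_nat_mul]
        simp
    _ ≤ _ := Real.exp_le_exp.2 (neg_le_neg h3)

end Exponent

end QuantumChannel

theorem mainTheorem4 {ι κ : Type*} [Fintype ι] [DecidableEq ι] [Fintype κ] [DecidableEq κ]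
    (T : Matrix ι ι ℂ →ₗ[ℂ] Matrix κ κ ℂ) (hT : QuantumChannel.IsChannel T)
    (c : ℝ) (hc : 0 ≤ c) (hcQ : (c : EReal) < QuantumChannel.quantumCapacity T) :
    ∃ l : ℝ, 0 < l ∧ ∀ᶠ n : ℕ in Filter.atTop,
      QuantumChannel.codingError (QuantumChannel.tensorPower T n) (2 ^ ⌊c * (n : ℝ)⌋₊) ≤
        ENNReal.ofReal (Real.exp (-((n : ℝ) * l))) := by
  obtain ⟨c', hQ⟩ := lt_iSup_iff.1 hcQ
  obtain ⟨⟨hc'0, hlim⟩, hcc⟩ := lt_iSup_iff.1 hQ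
  replace hcc : c < c' := EReal.coe_lt_coe_iff.1 hcc
  have hc' : 0 < c' := hc.trans_lt hcc
  have hγ : 0 < c' - c := sub_pos.2 hcc
  -- The fraction `1 / L` of correctable block errors costs a part `4 / L` of the rate.
  obtain ⟨L, hL⟩ := exists_nat_ge (16 * c' / (c' - c))
  rw [div_le_iff₀' hγ] at hL
  have hL0 : 0 < L := Nat.pos_of_ne_zero fun h => by
    rw [h, Nat.cast_zero, mul_zero] at hL
    linarith
  have hε : (0 : ENNReal) < (8 : ENNReal)⁻¹ ^ L := ENNReal.pow_pos (by simp) L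
  -- The number of blocks is `⌊n / m⌋`, and a code costs about two qubits per block: `m` is large
  -- enough for this, and the rounding in `a`, to be a small part of the rate.
  obtain ⟨m, hlt, hm12, hm1⟩ := ((hlim.eventually_lt_const hε).and
    ((tendsto_natCast_atTop_atTop.eventually_ge_atTop (12 / (c' - c))).and
      (tendsto_natCast_atTop_atTop.eventually_ge_atTop (1 / c')))).exists
  rw [div_le_iff₀' hγ] at hm12
  rw [div_le_iff₀' hc'] at hm1
  have hm0 : 0 < m := Nat.pos_of_ne_zero fun h => by
    rw [h, Nat.cast_zero, mul_zero] at hm1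
    linarith
  set a := ⌊c' * (m : ℝ)⌋₊ with ha
  have ha0 : a ≠ 0 := by
    have : 1 ≤ a := Nat.le_floor (by simpa using hm1)
    omega
  have h2a : 2 ^ a ≤ ⌊(2 : ℝ) ^ (c' * (m : ℝ))⌋₊ := by
    refine Nat.le_floor ?_
    rw [Nat.cast_pow, Nat.cast_ofNat, ← Real.rpow_natCast]
    exact Real.rpow_le_rpow_of_exponent_le one_le_two (Nat.floor_le (by positivity))
  have : Nonempty κ := by
    obtain ⟨x⟩ := QuantumChannel.nonempty_of_codingError_ne_top
      (lt_of_lt_of_le (by positivity) h2a) hlt.ne_top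
    exact ⟨x ⟨0, hm0⟩⟩
  classical
  let F := GaloisField 2 a
  let : Fintype F := Fintype.ofFinite F
  have hF : Fintype.card F = 2 ^ a := by
    rw [← Nat.card_eq_fintype_card]
    exact GaloisField.card 2 a ha0
  obtain ⟨E, hE, D, hD, hED⟩ :=
    QuantumChannel.exists_coding_of_codingError_lt (S := F) hlt (hF.trans_le h2a)
  refine ⟨1 / (2 * m), by positivity, ?_⟩
  filter_upwards [tendsto_natCast_atTop_atTop.eventually_ge_atTop
    ((6 * c' * m + 8) / (c' - c)), Filter.eventually_ge_atTop (2 * m)] with n hn hn2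
  rw [div_le_iff₀' hγ] at hn
  obtain ⟨hr, hM⟩ := QuantumChannel.rate_bound hc hcc hL hm12 hm1 ha hn
  exact (QuantumChannel.codingError_le_of_block hT ha0 hL0 hF hE hD hED.le hr hM).trans
    (QuantumChannel.inv_four_pow_div_le_exp hm0 hn2)
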